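/- **Theorem (Geometric Formulation of Schrödinger Evolution).** Let $\hbar>0$, let $\mathcal H$ be a complex Hilbert space (inner product antilinear in the first argument) and let $\hat H$ be a densely defined (possibly unbounded) self-adjoint operator on $\mathcal H$ with domain $D$, equipped with the graph inner product. Let $\mathcal P(\mathcal H)=(\mathcal H\setminus\{0\})/\mathbb C^\times$ and $\mathcal P(D)$ be the projective spaces, with the smooth manifold structure given by affine charts, let $\pi:\mathcal H\setminus\{0\}\to\mathcal P(\mathcal H)$ be the natural projection, and let $\omega$ be the Fubini–Study symplectic form on $\mathcal P(\mathcal H)$, normalised by $$(\pi^*\omega)_\psi(u,v)=2\hbar\,\operatorname{Im}\frac{\langle u|v\rangle\langle\psi|\psi\rangle-\langle u|\psi\rangle\langle\psi|v\rangle}{\langle\psi|\psi\rangle^2}.$$ Then: 1. The inclusion $\iota:\mathcal P(D)\to\mathcal P(\mathcal H)$ and the expectation value function $H:\mathcal P(D)\to\mathbb R$, $H([\psi])=\langle\psi|\hat H\psi\rangle/\langle\psi|\psi\rangle$, are smooth, and there is a unique Hamiltonian vector field $X_H$ of $H$, i.e. a unique assignment $x\mapsto X_H(x)\in T_{\iota(x)}\mathcal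 P(\mathcal H)$ for $x\in\mathcal P(D)$, with $\omega(X_H(x),d\iota_x v)=dH_x(v)$ for all $v\in T_x\mathcal P(D)$. 2. There is a unique Schrödinger evolution $U(t)=e^{-it\hat H/\hbar}$, i.e. a unique strongly continuous one-parameter group of unitary operators that preserves $D$ and satisfies $i\hbar\frac{d}{dt}U(t)\psi=\hat H U(t)\psi$ for all $\psi\in D$ and $t\in\mathbb R$. 3. The Hamiltonian flow of $X_H$ is the projection of the Schrödinger evolution: $\Phi_t([\psi])=[U(t)\psi]$ is the one and only continuous flow $\Phi:\mathbb R\times\mathcal P(\mathcal H)\to\mathcal P(\mathcal H)$ that preserves $\mathcal P(D)$ and whose orbits in $\mathcal P(D)$ are differentiable curves in $\mathcal P(\mathcal H)$ with velocity $X_H$. Moreover, if $J\ni 0$ is an open interval and $c:J\to\mathcal P(D)$ is any map that is differentiable as a curve in $\mathcal P(\mathcal H)$ with $\dot c(t)=X_H(c(t))$ for all $t\in J$, then $c(t)=[U(t)\psi]$ for all $t\in J$, where $c(0)=[\psi]$. If $\hat H$ is bounded, then $\mathcal P(D)=\mathcal P(\mathcal H)$, and $H$ and $X_H$ are defined everywhere.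 -/

import Mathlib

open scoped Manifold ContDiff LinearAlgebra.Projectivization InnerProductSpace

noncomputable section

/-! ### Projective Hilbert space as a smooth manifold -/

namespace ProjectiveHilbert

section Manifold

variable (E : Type*) [NormedAddCommGroup E] [InnerProductSpace ℂ E]

/-- The quotient topology on the projective space `(E ∖ {0}) / ℂˣ`. -/
instance instTopologicalSpace : TopologicalSpace (ℙ ℂ E) :=
  TopologicalSpace.coinduced (fun ψ : {v : E // v ≠ 0} => Projectivization.mk ℂ ψ.1 ψ.2)
    inferInstance

theorem exists_baseVec : ∃ e : E, Nontrivial E → ‖e‖ = 1 := by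
  by_cases h : Nontrivial E
  · obtain ⟨x, hx⟩ := exists_ne (0 : E)
    refine ⟨((‖x‖ : ℂ)⁻¹) • x, fun _ => ?_⟩
    have : ‖x‖ ≠ 0 := norm_ne_zero_iff.2 hx
    rw [norm_smul, norm_inv, Complex.norm_real, norm_norm, inv_mul_cancel₀ this]
  · exact ⟨0, fun h' => absurd h' h⟩

/-- A fixed unit vector of `E` (when `E` is nonzero). -/
def baseVec : E := Classical.choose (exists_baseVec E)

theorem norm_baseVec [h : Nontrivial E] : ‖baseVec E‖ = 1 :=
  Classical.choose_spec (exists_baseVec E) h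

/-- The model space of `ℙ ℂ E`: the orthogonal complement of a fixed unit vector. -/
abbrev Model : Type _ := ↥((ℂ ∙ baseVec E)ᗮ)

variable {E}

theorem inner_baseVec_model (v : Model E) : ⟪baseVec E, (v : E)⟫_ℂ = 0 :=
  Submodule.mem_orthogonal_singleton_iff_inner_right.1 v.2

theorem inner_baseVec_add [Nontrivial E] (v : Model E) :
    ⟪baseVec E, baseVec E + (v : E)⟫_ℂ = 1 := by
  rw [inner_add_right, inner_baseVec_model, inner_self_eq_norm_sq_to_K, norm_baseVec]
  simp

theorem frame_add_ne_zero [Nontrivial E] (T : E ≃ₗᵢ[ℂ] E) (v : Model E) :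
    T (baseVec E + (v : E)) ≠ 0 := by
  intro h
  have h0 : baseVec E + (v : E) = 0 := T.map_eq_zero_iff.1 h
  have := inner_baseVec_add v
  rw [h0, inner_zero_right] at this
  exact zero_ne_one this

/-- The affine coordinate `[ψ] ↦ T⁻¹ψ / ⟨e, T⁻¹ψ⟩ - e ∈ eᗮ` attached to a unitary `T`, where `e` is
the fixed unit vector (the orthogonal projection to `eᗮ` subtracts `e`). -/
def coord (T : E ≃ₗᵢ[ℂ] E) (p : ℙ ℂ E) : Model E :=
  p.lift (fun ψ => (ℂ ∙ baseVec E)ᗮ.orthogonalProjectionOnto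
      ((⟪baseVec E, T.symm ψ.1⟫_ℂ)⁻¹ • T.symm ψ.1)) (by
    rintro ⟨a, ha⟩ ⟨b, hb⟩ t rfl
    have ht : t ≠ 0 := by rintro rfl; simp at ha
    congr 1
    simp only [map_smul, inner_smul_right, smul_smul, mul_inv]
    congr 1
    field_simp)

theorem coord_mk (T : E ≃ₗᵢ[ℂ] E) (ψ : E) (hψ : ψ ≠ 0) :
    coord T (Projectivization.mk ℂ ψ hψ) = (ℂ ∙ baseVec E)ᗮ.orthogonalProjectionOnto
      ((⟪baseVec E, T.symm ψ⟫_ℂ)⁻¹ • T.symm ψ) := rfl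

/-- The domain of the affine coordinate: the lines that are not orthogonal to `T e`. -/
def coordSource (T : E ≃ₗᵢ[ℂ] E) : Set (ℙ ℂ E) := {p | ⟪baseVec E, T.symm p.rep⟫_ℂ ≠ 0}

theorem mk_mem_coordSource (T : E ≃ₗᵢ[ℂ] E) (ψ : E) (hψ : ψ ≠ 0) :
    Projectivization.mk ℂ ψ hψ ∈ coordSource T ↔ ⟪baseVec E, T.symm ψ⟫_ℂ ≠ 0 := by
  obtain ⟨a, ha⟩ := Projectivization.exists_smul_eq_mk_rep ℂ ψ hψ
  have h : (Projectivization.mk ℂ ψ hψ).rep = (a : ℂ) • ψ := ha.symm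
  simp [coordSource, h]

theorem baseVec_add_proj [Nontrivial E] (x : E) (hx : ⟪baseVec E, x⟫_ℂ ≠ 0) :
    baseVec E + (((ℂ ∙ baseVec E)ᗮ.orthogonalProjectionOnto ((⟪baseVec E, x⟫_ℂ)⁻¹ • x) : Model E) : E)
      = (⟪baseVec E, x⟫_ℂ)⁻¹ • x := by
  have h := Submodule.starProjection_add_starProjection_orthogonal (K := (ℂ ∙ baseVec E))
    ((⟪baseVec E, x⟫_ℂ)⁻¹ • x)
  rw [Submodule.starProjection_unit_singleton ℂ (norm_baseVec E), inner_smul_right,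
    inv_mul_cancel₀ hx, one_smul] at h
  exact h

theorem proj_baseVec_add (v : Model E) :
    (ℂ ∙ baseVec E)ᗮ.orthogonalProjectionOnto (baseVec E + (v : E)) = v := by
  rw [map_add, Submodule.orthogonalProjectionOnto_mem_subspace_eq_self,
    Submodule.orthogonalProjectionOnto_orthogonal_apply_eq_zero (Submodule.mem_span_singleton_self _),
    zero_add]

theorem continuous_mk :
    Continuous (fun ψ : {v : E // v ≠ 0} => Projectivization.mk ℂ ψ.1 ψ.2) :=
  continuous_coinduced_rng

theorem isOpen_coordSource (T : E ≃ₗᵢ[ℂ] E) : IsOpen (coordSource T) := by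
  rw [isOpen_coinduced]
  have : (fun ψ : {v : E // v ≠ 0} => Projectivization.mk ℂ ψ.1 ψ.2) ⁻¹' coordSource T
      = {ψ | ⟪baseVec E, T.symm ψ.1⟫_ℂ ≠ 0} := by
    ext ψ
    exact mk_mem_coordSource T ψ.1 ψ.2
  rw [this]
  exact isOpen_ne_fun (by fun_prop) continuous_const

/-- The affine chart of `ℙ ℂ E` attached to a unitary `T`; its inverse is `v ↦ [T (e + v)]`. -/
def chart [Nontrivial E] (T : E ≃ₗᵢ[ℂ] E) : OpenPartialHomeomorph (ℙ ℂ E) (Model E) where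
  toFun := coord T
  invFun v := Projectivization.mk ℂ (T (baseVec E + (v : E))) (frame_add_ne_zero T v)
  source := coordSource T
  target := Set.univ
  map_source' _ _ := Set.mem_univ _
  map_target' v _ := by
    rw [mk_mem_coordSource, LinearIsometryEquiv.symm_apply_apply, inner_baseVec_add]
    exact one_ne_zero
  left_inv' p hp := by
    induction p using Projectivization.ind with
    | h ψ hψ =>
      rw [mk_mem_coordSource] at hp
      rw [Projectivization.mk_eq_mk_iff']
      refine ⟨(⟪baseVec E, T.symm ψ⟫_ℂ)⁻¹, ?_⟩
      rw [coord_mk, baseVec_add_proj _ hp, map_smul, LinearIsometryEquiv.apply_symm_apply]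
  right_inv' v _ := by
    rw [coord_mk, LinearIsometryEquiv.symm_apply_apply, inner_baseVec_add, inv_one, one_smul,
      proj_baseVec_add]
  open_source := isOpen_coordSource T
  open_target := isOpen_univ
  continuousOn_toFun := by
    rw [continuousOn_open_iff (isOpen_coordSource T)]
    intro t ht
    rw [isOpen_coinduced]
    have hc : ContinuousOn (fun ψ : {v : E // v ≠ 0} => (ℂ ∙ baseVec E)ᗮ.orthogonalProjectionOnto
        ((⟪baseVec E, T.symm ψ.1⟫_ℂ)⁻¹ • T.symm ψ.1)) {ψ | ⟪baseVec E, T.symm ψ.1⟫_ℂ ≠ 0} := by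
      refine (ContinuousLinearMap.continuous _).comp_continuousOn ?_
      refine ContinuousOn.smul (ContinuousOn.inv₀ (Continuous.continuousOn (by fun_prop))
        (fun ψ hψ => hψ)) (Continuous.continuousOn (by fun_prop))
    have := hc.isOpen_inter_preimage
      (isOpen_ne_fun (by fun_prop) continuous_const) ht
    convert this using 1
    ext ψ
    simp only [Set.preimage_inter, Set.mem_inter_iff, Set.mem_preimage, Set.mem_ofPred_eq]
    rw [mk_mem_coordSource]
    rfl
  continuousOn_invFun := by
    refine Continuous.continuousOn ?_
    exact continuous_mk.comp
      (Continuous.subtype_mk (f := fun v : Model E => T (baseVec E + (v : E))) (by fun_prop)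
        (fun v => frame_add_ne_zero T v))

/-- The unitary group acts transitively on lines. -/
theorem exists_frame (p : ℙ ℂ E) : ∃ T : E ≃ₗᵢ[ℂ] E, T (baseVec E) ∈ p.submodule := by
  have hp := p.rep_nonzero
  have : Nontrivial E := ⟨p.rep, 0, hp⟩
  set e := baseVec E with he
  have hen : ‖e‖ = 1 := norm_baseVec E
  obtain ⟨f, hfn, hfp, r, hr, hef⟩ : ∃ f : E, ‖f‖ = 1 ∧ f ∈ p.submodule ∧
      ∃ r : ℝ, 0 ≤ r ∧ ⟪e, f⟫_ℂ = (r : ℂ) := by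
    have hn : ‖p.rep‖ ≠ 0 := norm_ne_zero_iff.2 hp
    have hmem : ∀ c : ℂ, c • p.rep ∈ p.submodule := fun c => by
      rw [Projectivization.submodule_eq]
      exact Submodule.smul_mem _ _ (Submodule.mem_span_singleton_self _)
    by_cases h0 : ⟪e, p.rep⟫_ℂ = 0
    · refine ⟨((‖p.rep‖ : ℂ)⁻¹) • p.rep, ?_, hmem _, 0, le_rfl, ?_⟩
      · rw [norm_smul, norm_inv, Complex.norm_real, norm_norm, inv_mul_cancel₀ hn]
      · rw [inner_smul_right, h0]; simp
    · have h0' : ‖⟪e, p.rep⟫_ℂ‖ ≠ 0 := norm_ne_zero_iff.2 h0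
      refine ⟨(star ⟪e, p.rep⟫_ℂ * ((‖⟪e, p.rep⟫_ℂ‖ * ‖p.rep‖ : ℝ) : ℂ)⁻¹) • p.rep, ?_, hmem _,
        ‖⟪e, p.rep⟫_ℂ‖ / ‖p.rep‖, by positivity, ?_⟩
      · rw [norm_smul, norm_mul, norm_star, norm_inv, Complex.norm_real, Real.norm_eq_abs,
          abs_of_nonneg (by positivity)]
        field_simp
      · rw [inner_smul_right, mul_right_comm, Complex.star_def, Complex.conj_mul']
        push_cast
        have h1 : (‖⟪e, p.rep⟫_ℂ‖ : ℂ) ≠ 0 := by exact_mod_cast h0'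
        have h2 : (‖p.rep‖ : ℂ) ≠ 0 := by exact_mod_cast hn
        field_simp
  refine ⟨(ℂ ∙ (e + f)).reflection, ?_⟩
  have hfe : ⟪f, e⟫_ℂ = (r : ℂ) := by
    rw [← inner_conj_symm, hef, Complex.conj_ofReal]
  have hee : ⟪e, e⟫_ℂ = 1 := by rw [inner_self_eq_norm_sq_to_K, hen]; simp
  have hff : ⟪f, f⟫_ℂ = 1 := by rw [inner_self_eq_norm_sq_to_K, hfn]; simp
  have hr1 : (1 + r : ℂ) ≠ 0 := by
    have : (1 + r : ℝ) ≠ 0 := by positivity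
    exact_mod_cast this
  have hnn : ((‖e + f‖ ^ 2 : ℝ) : ℂ) = 2 * (1 + r) := by
    have := inner_self_eq_norm_sq_to_K (𝕜 := ℂ) (e + f)
    rw [inner_add_left, inner_add_right, inner_add_right, hee, hef, hfe, hff] at this
    push_cast
    refine this.symm.trans ?_
    ring
  have key : (ℂ ∙ (e + f)).reflection e = f := by
    rw [Submodule.reflection_singleton_apply, inner_add_left, hee, hfe]
    have h2 : ((‖e + f‖ : ℂ) ^ 2) = 2 * (1 + r) := by exact_mod_cast hnn
    have h3 : (1 + (r : ℂ)) / ((‖e + f‖ : ℂ) ^ 2) = 1 / 2 := by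
      rw [h2]; field_simp
    have h4 : ∀ x : E, (2 : ℕ) • ((1 / 2 : ℂ) • x) = x := fun x => by
      rw [← Nat.cast_smul_eq_nsmul ℂ, smul_smul]; norm_num
    erw [h3]
    rw [h4]
    abel
  rw [key]
  exact hfp

/-- A unitary that moves the fixed unit vector into the line `p`. -/
def frameAt (p : ℙ ℂ E) : E ≃ₗᵢ[ℂ] E := Classical.choose (exists_frame p)

theorem frameAt_mem (p : ℙ ℂ E) : frameAt p (baseVec E) ∈ p.submodule :=
  Classical.choose_spec (exists_frame p)

theorem nontrivial_of_point (p : ℙ ℂ E) : Nontrivial E := ⟨p.rep, 0, p.rep_nonzero⟩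

theorem mem_coordSource_frameAt (p : ℙ ℂ E) : p ∈ coordSource (frameAt p) := by
  have := nontrivial_of_point p
  have h := frameAt_mem p
  rw [Projectivization.submodule_eq, Submodule.mem_span_singleton] at h
  obtain ⟨a, ha⟩ := h
  intro h0
  have : ⟪baseVec E, (frameAt p).symm (a • p.rep)⟫_ℂ = 0 := by
    rw [map_smul, inner_smul_right, h0, mul_zero]
  rw [ha, LinearIsometryEquiv.symm_apply_apply, inner_self_eq_norm_sq_to_K, norm_baseVec] at this
  simp at this

/-- The charted space structure of `ℙ ℂ E` given by all affine charts; the preferred chart at `p`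
is centred at `p`. -/
instance instChartedSpace : ChartedSpace (Model E) (ℙ ℂ E) where
  atlas := {φ | ∃ (_ : Nontrivial E) (T : E ≃ₗᵢ[ℂ] E), φ = chart T}
  chartAt p := haveI := nontrivial_of_point p; chart (frameAt p)
  mem_chart_source p := mem_coordSource_frameAt p
  chart_mem_atlas p := ⟨nontrivial_of_point p, frameAt p, rfl⟩

instance instIsManifold (n : ℕ∞ω) : IsManifold 𝓘(ℝ, Model E) n (ℙ ℂ E) := by
  refine isManifold_of_contDiffOn _ n _ ?_
  rintro _ _ ⟨_, T, rfl⟩ ⟨_, T', rfl⟩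
  have hc : ContDiffOn ℂ n (fun v : Model E => (ℂ ∙ baseVec E)ᗮ.orthogonalProjectionOnto
      ((⟪baseVec E, T'.symm (T (baseVec E + (v : E)))⟫_ℂ)⁻¹ • T'.symm (T (baseVec E + (v : E)))))
      {v | ⟪baseVec E, T'.symm (T (baseVec E + (v : E)))⟫_ℂ ≠ 0} := by
    have h1 : ContDiff ℂ n (fun v : Model E => T'.symm (T (baseVec E + (v : E)))) :=
      T'.symm.contDiff.comp (T.contDiff.comp
        (contDiff_const.add ((Submodule.subtypeL (ℂ ∙ baseVec E)ᗮ).contDiff)))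
    have h2 : ContDiff ℂ n (fun v : Model E => ⟪baseVec E, T'.symm (T (baseVec E + (v : E)))⟫_ℂ) :=
      (innerSL ℂ (baseVec E)).contDiff.comp h1
    exact (ContinuousLinearMap.contDiff _).comp_contDiffOn
      ((h2.contDiffOn.inv (fun v hv => hv)).smul h1.contDiffOn)
  refine (hc.restrict_scalars ℝ).congr_mono (fun v _ => rfl) ?_
  rintro v ⟨hv, _⟩
  have : Projectivization.mk ℂ (T (baseVec E + (v : E))) (frame_add_ne_zero T v)
    ∈ coordSource T' := hv.2
  exact (mk_mem_coordSource _ _ _).1 this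

/-- The open set `E ∖ {0}`. -/
def nonzeroVectors (E : Type*) [NormedAddCommGroup E] : TopologicalSpace.Opens E :=
  ⟨{0}ᶜ, isOpen_compl_singleton⟩

/-- The natural projection `π : E ∖ {0} → ℙ ℂ E`. -/
def proj (ψ : nonzeroVectors E) : ℙ ℂ E := Projectivization.mk ℂ (ψ : E) ψ.2

/-! ### The Fubini–Study symplectic form -/

/-- The pullback to `E ∖ {0}` of the Fubini–Study form, normalised so that on horizontal vectors at
a unit vector it is `Ω(u, v) = 2 ℏ Im ⟨u, v⟩`. -/
def fubiniStudyLift (hbar : ℝ) (ψ u v : E) : ℝ :=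
  2 * hbar * ((⟪u, v⟫_ℂ * ⟪ψ, ψ⟫_ℂ - ⟪u, ψ⟫_ℂ * ⟪ψ, v⟫_ℂ) / ⟪ψ, ψ⟫_ℂ ^ 2).im

/-- The Fubini–Study symplectic form on `ℙ ℂ E`. The inverse `v ↦ [T (e + v)]` of the preferred
chart at `p` lifts to the local section `v ↦ T (e + v)` of `π`, which passes through
`T e ∈ p` at `v = 0`, with derivative `T`. The form is the value of `fubiniStudyLift` on
the lifted vectors; `fubiniStudyForm_mfderiv_proj` shows that it does not depend on the lift. -/
def fubiniStudyForm (hbar : ℝ) (p : ℙ ℂ E) (X Y : TangentSpace 𝓘(ℝ, Model E) p) : ℝ :=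
  let X' : Model E := X
  let Y' : Model E := Y
  fubiniStudyLift hbar (frameAt p (baseVec E)) (frameAt p (X' : E)) (frameAt p (Y' : E))

/-- The derivative of `π` at `ψ`, in the preferred chart at `π ψ`. -/
theorem hasMFDerivAt_proj (ψ : nonzeroVectors E) (c : ℂ)
    (hc : (frameAt (proj ψ)).symm (ψ : E) = c • baseVec E) :
    HasMFDerivAt 𝓘(ℝ, E) 𝓘(ℝ, Model E) proj ψ
      ((c⁻¹ • ((ℂ ∙ baseVec E)ᗮ.orthogonalProjectionOnto ∘L
        ((frameAt (proj ψ)).symm.toContinuousLinearEquiv : E →L[ℂ] E))).restrictScalars ℝ) := by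
  have : Nontrivial E := nontrivial_of_point (proj ψ)
  refine ⟨continuous_mk.continuousAt, ?_⟩
  set T := frameAt (proj ψ) with hT
  have hee : ⟪baseVec E, baseVec E⟫_ℂ = 1 := by
    rw [inner_self_eq_norm_sq_to_K, norm_baseVec]; simp
  have hic : ⟪baseVec E, T.symm (ψ : E)⟫_ℂ = c := by rw [hc, inner_smul_right, hee, mul_one]
  have hc0 : c ≠ 0 := by
    rintro rfl
    rw [zero_smul] at hc
    exact ψ.2 (T.symm.map_eq_zero_iff.1 hc)
  have hd1 : HasFDerivAt (𝕜 := ℂ) (fun v : E => T.symm v)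
      (T.symm.toContinuousLinearEquiv : E →L[ℂ] E) (ψ : E) :=
    (T.symm.toContinuousLinearEquiv : E →L[ℂ] E).hasFDerivAt
  have hd2 := ((innerSL ℂ (baseVec E)).hasFDerivAt (x := T.symm (ψ : E))).comp (ψ : E) hd1
  have hi := (hasDerivAt_inv (𝕜 := ℂ) (x := ⟪baseVec E, T.symm (ψ : E)⟫_ℂ)
    (by rw [hic]; exact hc0)).hasFDerivAt
  have hd3 := (hi.comp (ψ : E) hd2).smul hd1
  have hd4 := ((ℂ ∙ baseVec E)ᗮ.orthogonalProjectionOnto.hasFDerivAt).comp (ψ : E) hd3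
  have hd5 := (hd4.restrictScalars ℝ).hasFDerivWithinAt (s := Set.range 𝓘(ℝ, E))
  have hev : writtenInExtChartAt 𝓘(ℝ, E) 𝓘(ℝ, Model E) ψ proj =ᶠ[nhds (ψ : E)]
      fun v => (ℂ ∙ baseVec E)ᗮ.orthogonalProjectionOnto
        ((⟪baseVec E, T.symm v⟫_ℂ)⁻¹ • T.symm v) := by
    filter_upwards [extChartAt_target_mem_nhds (I := 𝓘(ℝ, E)) ψ] with v hv
    have hv' : (((extChartAt 𝓘(ℝ, E) ψ).symm v : nonzeroVectors E) : E) = v :=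
      (extChartAt 𝓘(ℝ, E) ψ).right_inv hv
    change (ℂ ∙ baseVec E)ᗮ.orthogonalProjectionOnto
      ((⟪baseVec E, T.symm (((extChartAt 𝓘(ℝ, E) ψ).symm v : nonzeroVectors E) : E)⟫_ℂ)⁻¹ •
        T.symm (((extChartAt 𝓘(ℝ, E) ψ).symm v : nonzeroVectors E) : E)) = _
    rw [hv']
  refine (hd5.congr_fderiv ?_).congr_of_eventuallyEq (hev.filter_mono nhdsWithin_le_nhds)
    hev.self_of_nhds
  ext u
  have hpe : (ℂ ∙ baseVec E)ᗮ.orthogonalProjectionOnto (baseVec E) = 0 :=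
    Submodule.orthogonalProjectionOnto_orthogonal_apply_eq_zero
      (Submodule.mem_span_singleton_self _)
  have hpe' : (ℂ ∙ baseVec E)ᗮ.orthogonalProjectionOnto (T.symm (ψ : E)) = 0 := by
    rw [hc, map_smul, hpe, smul_zero]
  simp [hpe', hic]

/-- The Fubini–Study form pulls back along `π` to `fubiniStudyLift`. -/
theorem fubiniStudyForm_mfderiv_proj (hbar : ℝ) (ψ : nonzeroVectors E) (u v : E) :
    fubiniStudyForm hbar (proj ψ) (mfderiv 𝓘(ℝ, E) 𝓘(ℝ, Model E) proj ψ u)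
      (mfderiv 𝓘(ℝ, E) 𝓘(ℝ, Model E) proj ψ v) = fubiniStudyLift hbar (ψ : E) u v := by
  have : Nontrivial E := nontrivial_of_point (proj ψ)
  obtain ⟨c, hc⟩ : ∃ c : ℂ, (frameAt (proj ψ)).symm (ψ : E) = c • baseVec E := by
    have h := frameAt_mem (proj ψ)
    rw [show (proj ψ).submodule = ℂ ∙ (ψ : E) from Projectivization.submodule_mk _ _,
      Submodule.mem_span_singleton] at h
    obtain ⟨a, ha⟩ := h
    have ha' : (frameAt (proj ψ)).symm (a • (ψ : E)) = baseVec E := by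
      rw [ha, LinearIsometryEquiv.symm_apply_apply]
    have ha0 : a ≠ 0 := by
      rintro rfl
      have := norm_baseVec E
      rw [← ha'] at this
      simp at this
    exact ⟨a⁻¹, by rw [← ha', map_smul, inv_smul_smul₀ ha0]⟩
  have hc0 : c ≠ 0 := by
    rintro rfl
    rw [zero_smul] at hc
    exact ψ.2 ((frameAt (proj ψ)).symm.map_eq_zero_iff.1 hc)
  rw [(hasMFDerivAt_proj ψ c hc).mfderiv]
  set T := frameAt (proj ψ) with hT
  set e := baseVec E with he
  have hee : ⟪e, e⟫_ℂ = 1 := by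
    rw [inner_self_eq_norm_sq_to_K, norm_baseVec]; simp
  have hψ : (ψ : E) = T (c • e) := by rw [← hc, T.apply_symm_apply]
  have hdec : ∀ w : E, T.symm w = ⟪e, T.symm w⟫_ℂ • e +
      (((ℂ ∙ e)ᗮ.orthogonalProjectionOnto (T.symm w) : Model E) : E) := fun w => by
    have h := Submodule.starProjection_add_starProjection_orthogonal (K := (ℂ ∙ e)) (T.symm w)
    rw [Submodule.starProjection_unit_singleton ℂ (norm_baseVec E)] at h
    exact h.symm
  set P : E → Model E := fun w => (ℂ ∙ e)ᗮ.orthogonalProjectionOnto (T.symm w) with hP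
  have hw : ∀ w : E, w = T (⟪e, T.symm w⟫_ℂ • e + (P w : E)) := fun w => by
    rw [← hdec, T.apply_symm_apply]
  have h1 : ∀ x : Model E, ⟪e, (x : E)⟫_ℂ = 0 := inner_baseVec_model
  have h2 : ∀ x : Model E, ⟪(x : E), e⟫_ℂ = 0 := fun x => by
    rw [← inner_conj_symm, h1, map_zero]
  change fubiniStudyLift hbar (T e) (T ((c⁻¹ • P u : Model E) : E))
    (T ((c⁻¹ • P v : Model E) : E)) = _
  conv_rhs => rw [hw u, hw v, hψ]
  set a := ⟪e, T.symm u⟫_ℂ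
  set b := ⟪e, T.symm v⟫_ℂ
  unfold fubiniStudyLift
  simp only [LinearIsometryEquiv.inner_map_map, Submodule.coe_smul, inner_smul_left,
    inner_smul_right, inner_add_left, inner_add_right, hee, h1, h2, mul_zero, add_zero, zero_add,
    mul_one, map_inv₀]
  congr 2
  have hcc : (starRingEnd ℂ) c ≠ 0 := by simpa using hc0
  field_simp
  ring

end Manifold

/-! ### The projective domain of an unbounded operator -/

section Domain

variable {E : Type*} [NormedAddCommGroup E] [InnerProductSpace ℂ E]

/-- The graph `{(ψ, A ψ) | ψ ∈ D(A)}` of an unbounded operator in `E ⊕ E`. -/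
def hilbertGraph (A : E →ₗ.[ℂ] E) : Submodule ℂ (WithLp 2 (E × E)) :=
  A.graph.comap (WithLp.linearEquiv 2 ℂ (E × E)).toLinearMap

/-- The domain `D(A)` with the graph inner product `⟨ψ, φ⟩ + ⟨A ψ, A φ⟩`, realised as the graph of
`A`. -/
abbrev Dom (A : E →ₗ.[ℂ] E) : Type _ := ↥(hilbertGraph A)

/-- The inclusion `D(A) → E`. -/
def Dom.incl (A : E →ₗ.[ℂ] E) : Dom A →ₗ[ℂ] E :=
  LinearMap.fst ℂ E E ∘ₗ (WithLp.linearEquiv 2 ℂ (E × E)).toLinearMap ∘ₗ (hilbertGraph A).subtype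

/-- The operator `A` as a map `D(A) → E`. -/
def Dom.op (A : E →ₗ.[ℂ] E) : Dom A →ₗ[ℂ] E :=
  LinearMap.snd ℂ E E ∘ₗ (WithLp.linearEquiv 2 ℂ (E × E)).toLinearMap ∘ₗ (hilbertGraph A).subtype

theorem Dom.op_eq (A : E →ₗ.[ℂ] E) (x : Dom A) :
    ∃ h : Dom.incl A x ∈ A.domain, Dom.op A x = A ⟨Dom.incl A x, h⟩ := by
  have hx : (Dom.incl A x, Dom.op A x) ∈ A.graph := x.2
  obtain ⟨y, hy1, hy2⟩ := (LinearPMap.mem_graph_iff A).1 hx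
  have h : Dom.incl A x ∈ A.domain := by rw [← show (y : E) = Dom.incl A x from hy1]; exact y.2
  refine ⟨h, ?_⟩
  rw [← show A y = Dom.op A x from hy2]
  congr 1
  exact Subtype.ext hy1

theorem Dom.incl_injective (A : E →ₗ.[ℂ] E) : Function.Injective (Dom.incl A) := by
  intro x y hxy
  have h : Dom.op A x = Dom.op A y := by
    obtain ⟨_, hx⟩ := Dom.op_eq A x
    obtain ⟨_, hy⟩ := Dom.op_eq A y
    rw [hx, hy]
    congr 1
    exact Subtype.ext hxy
  exact Subtype.ext ((WithLp.linearEquiv 2 ℂ (E × E)).injective (Prod.ext hxy h))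

/-- The inclusion `P(D(A)) → P(E)`. -/
def projIncl (A : E →ₗ.[ℂ] E) : ℙ ℂ (Dom A) → ℙ ℂ E :=
  Projectivization.map (Dom.incl A) (Dom.incl_injective A)

/-- The expectation value function `[ψ] ↦ ⟨ψ, A ψ⟩ / ⟨ψ, ψ⟩` on `P(D(A))` (the inner product
`⟨ψ, A ψ⟩` is real when `A` is symmetric). -/
def expectation (A : E →ₗ.[ℂ] E) (x : ℙ ℂ (Dom A)) : ℝ :=
  x.lift (fun ψ => (⟪Dom.incl A ψ.1, Dom.op A ψ.1⟫_ℂ / ⟪Dom.incl A ψ.1, Dom.incl A ψ.1⟫_ℂ).re) (by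
    rintro ⟨a, ha⟩ ⟨b, hb⟩ t rfl
    have ht : t ≠ 0 := by rintro rfl; simp at ha
    have ht' : (starRingEnd ℂ) t ≠ 0 := by simpa using ht
    simp only [map_smul, inner_smul_left, inner_smul_right]
    congr 1
    field_simp)

/-! ### Hamiltonian vector fields and flows, Schrödinger evolution -/

/-- `X` is the Hamiltonian vector field of the expectation value function `H` of `A`, i.e.
`ι_X ω = dH`. As usual for unbounded `A`, the vector field is defined on `P(D(A))`, with values
tangent to `P(E)`, and the identity `ω(X, v) = dH(v)` is required for all `v` tangent
to `P(D(A))`. -/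
def IsHamiltonianVectorField (hbar : ℝ) (A : E →ₗ.[ℂ] E)
    (X : (x : ℙ ℂ (Dom A)) → TangentSpace 𝓘(ℝ, Model E) (projIncl A x)) : Prop :=
  ∀ (x : ℙ ℂ (Dom A)) (v : TangentSpace 𝓘(ℝ, Model (Dom A)) x),
    fubiniStudyForm hbar (projIncl A x) (X x)
        (mfderiv 𝓘(ℝ, Model (Dom A)) 𝓘(ℝ, Model E) (projIncl A) x v)
      = mfderiv 𝓘(ℝ, Model (Dom A)) 𝓘(ℝ, ℝ) (expectation A) x v

/-- On `J`, the curve `c` in `P(D(A))` is differentiable as a curve in `P(E)` and its velocity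
at time `t` is `X (c t)`. -/
def IsTrajectoryOn (A : E →ₗ.[ℂ] E)
    (X : (x : ℙ ℂ (Dom A)) → TangentSpace 𝓘(ℝ, Model E) (projIncl A x))
    (c : ℝ → ℙ ℂ (Dom A)) (J : Set ℝ) : Prop :=
  ∀ t ∈ J, HasMFDerivAt 𝓘(ℝ, ℝ) 𝓘(ℝ, Model E) (fun s => projIncl A (c s)) t
    ((1 : ℝ →L[ℝ] ℝ).smulRight (X (c t)))

/-- `Φ` is a flow on `P(E)` generated by `X`: a continuous action of `ℝ` that preserves `P(D(A))`
and whose orbits in `P(D(A))` are integral curves of `X`. -/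
structure IsFlowOf (A : E →ₗ.[ℂ] E)
    (X : (x : ℙ ℂ (Dom A)) → TangentSpace 𝓘(ℝ, Model E) (projIncl A x))
    (Φ : ℝ → ℙ ℂ E → ℙ ℂ E) : Prop where
  map_zero : ∀ p, Φ 0 p = p
  map_add : ∀ s t p, Φ (s + t) p = Φ s (Φ t p)
  continuous : Continuous fun q : ℝ × ℙ ℂ E => Φ q.1 q.2
  integralCurve : ∀ x : ℙ ℂ (Dom A), ∃ c : ℝ → ℙ ℂ (Dom A),
    (∀ t, projIncl A (c t) = Φ t (projIncl A x)) ∧ IsTrajectoryOn A X c Set.univ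

/-- `U` is the Schrödinger evolution `exp (-i t A / ℏ)`: a strongly continuous one-parameter group
of unitary operators that preserves `D(A)` and solves `i ℏ dψ/dt = A ψ` for all initial values
in `D(A)`. -/
structure IsSchrodingerEvolution (hbar : ℝ) (A : E →ₗ.[ℂ] E) (U : ℝ → E ≃ₗᵢ[ℂ] E) : Prop where
  map_zero : ∀ ψ, U 0 ψ = ψ
  map_add : ∀ s t ψ, U (s + t) ψ = U s (U t ψ)
  continuous : ∀ ψ, Continuous fun t => U t ψ
  schrodinger : ∀ (ψ : A.domain) (t : ℝ), ∃ h : U t (ψ : E) ∈ A.domain,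
    HasDerivAt (fun s => U s (ψ : E)) (-(Complex.I / (hbar : ℂ)) • A ⟨U t (ψ : E), h⟩) t

/-- The map of `P(E)` induced by a unitary operator. -/
def projUnitary (T : E ≃ₗᵢ[ℂ] E) : ℙ ℂ E → ℙ ℂ E :=
  Projectivization.map T.toLinearEquiv.toLinearMap T.injective

end Domain

end ProjectiveHilbert

end

open ProjectiveHilbert

open Filter Topology

/-! ### Strong limits of unitary groups with bounded generators -/

section UnitaryGroup

variable {E : Type*} [NormedAddCommGroup E] [InnerProductSpace ℂ E] [CompleteSpace E]

/-! Write `A` for the Hamiltonian. Existence of the evolution is Stone's theorem, proved by Yosida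
approximation. Self-adjointness gives resolvents at all nonzero imaginary points. The bounded
self-adjoint operators `r² A / (A² + r²)`, built from the resolvents at `± i r`, commute and
converge strongly to `A` on its domain. For commuting skew-adjoint generators, the distance between
two exponentials at `x` is at most `|t|` times the distance between the generators at `x`. The
unitary groups therefore converge locally uniformly in time, and the limit commutes with the
resolvents, so it preserves the domain.

On projective space, the candidate vector field is the image of `-i A ψ / ℏ` under the differential
of the projection. Everything is computed on representing vectors: the quotient rule and symmetry of
`A` turn the derivative of the expectation value into the Fubini–Study pairing with this vector
(`hasDerivAt_vecExpectation`). Since the form is only tested on vectors tangent to `P(D)`,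
uniqueness needs the density of these in the tangent space of the full projective space, plus
nondegeneracy.

Uniqueness of trajectories cannot rest on a Lipschitz estimate, because the field is not even
defined everywhere. Instead a conserved quantity is used: the overlap of the moving line with a
Schrödinger solution `U t ψ`. A local lift of a trajectory solves the Schrödinger equation up to a
multiple of itself; this multiple cancels in the normalised overlap, which is therefore constant.
Starting on the line of `ψ`, it has its maximal value `‖ψ‖²`, and the equality case of
Cauchy–Schwarz keeps the two lines equal. Uniqueness of the flow follows by density of `P(D)` and
the Hausdorff property. -/

theorem smul_mem_skewAdjoint_real {K : E →L[ℂ] E} (hK : K ∈ skewAdjoint (E →L[ℂ] E)) (t : ℝ) :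
    t • K ∈ skewAdjoint (E →L[ℂ] E) := by
  rw [skewAdjoint.mem_iff] at hK ⊢
  rw [star_smul, hK, smul_neg]
  simp

theorem norm_exp_smul_apply {K : E →L[ℂ] E} (hK : K ∈ skewAdjoint (E →L[ℂ] E)) (t : ℝ) (x : E) :
    ‖NormedSpace.exp (t • K) x‖ = ‖x‖ := by
  let +nondep : NormedAlgebra ℚ (E →L[ℂ] E) := .restrictScalars ℚ ℂ _
  have hu : NormedSpace.exp (t • K) ∈ unitary (E →L[ℂ] E) :=
    NormedSpace.exp_mem_unitary_of_mem_skewAdjoint (smul_mem_skewAdjoint_real hK t)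
  exact ContinuousLinearMap.norm_map_of_mem_unitary hu x

theorem hasDerivAt_exp_smul_apply (K : E →L[ℂ] E) (x : E) (t : ℝ) :
    HasDerivAt (fun s : ℝ => NormedSpace.exp (s • K) x) (NormedSpace.exp (t • K) (K x)) t := by
  have h := hasDerivAt_exp_smul_const (𝕂 := ℝ) K t
  have := (((ContinuousLinearMap.apply ℂ E x).restrictScalars ℝ).hasFDerivAt).comp_hasDerivAt t h
  simpa [Function.comp_def] using this

/-- Mean value inequality: the velocity `exp (s K) (K x)` has the constant norm `‖K x‖`. -/
theorem norm_exp_smul_apply_sub_le {K : E →L[ℂ] E} (hK : K ∈ skewAdjoint (E →L[ℂ] E)) (t : ℝ)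
    (x : E) : ‖NormedSpace.exp (t • K) x - x‖ ≤ ‖K x‖ * |t| := by
  have := Convex.norm_image_sub_le_of_norm_hasDerivWithin_le (s := Set.univ) (x := 0) (y := t)
    (fun s _ => (hasDerivAt_exp_smul_apply K x s).hasDerivWithinAt)
    (fun s _ => (norm_exp_smul_apply hK s (K x)).le) convex_univ (Set.mem_univ _) (Set.mem_univ _)
  simpa using this

/-- By commutativity `exp (t K) = exp (t L) exp (t (K - L))`. The isometry `exp (t L)` drops out of
the norm, leaving the previous estimate for `K - L`. -/
theorem norm_exp_smul_sub_exp_smul_le {K L : E →L[ℂ] E} (hK : K ∈ skewAdjoint (E →L[ℂ] E))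
    (hL : L ∈ skewAdjoint (E →L[ℂ] E)) (h : Commute K L) (t : ℝ) (x : E) :
    ‖NormedSpace.exp (t • K) x - NormedSpace.exp (t • L) x‖ ≤ ‖K x - L x‖ * |t| := by
  let +nondep : NormedAlgebra ℚ (E →L[ℂ] E) := .restrictScalars ℚ ℂ _
  have hc : Commute (t • L) (t • (K - L)) :=
    ((h.symm.sub_right (Commute.refl L)).smul_left t).smul_right t
  have he : NormedSpace.exp (t • K) = NormedSpace.exp (t • L) * NormedSpace.exp (t • (K - L)) := by
    rw [← NormedSpace.exp_add_of_commute hc, ← smul_add, add_sub_cancel]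
  rw [he, mul_apply_eq_comp, ← map_sub, norm_exp_smul_apply hL]
  simpa using norm_exp_smul_apply_sub_le (sub_mem hK hL) t x

/-- Commuting bounded skew-adjoint operators that converge strongly on a dense subspace have
exponentials that converge, uniformly on bounded time intervals, at every vector. -/
theorem uniform_cauchy_exp_smul {K : ℕ → E →L[ℂ] E}
    (hK : ∀ n, K n ∈ skewAdjoint (E →L[ℂ] E)) (hcomm : ∀ n m, Commute (K n) (K m))
    {D : Submodule ℂ E} (hD : Dense (D : Set E)) (hk : ∀ x ∈ D, CauchySeq fun n => K n x)
    (x : E) (T : ℝ) {ε : ℝ} (hε : 0 < ε) :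
    ∃ N, ∀ n ≥ N, ∀ m ≥ N, ∀ t : ℝ, |t| ≤ T →
      ‖NormedSpace.exp (t • K n) x - NormedSpace.exp (t • K m) x‖ ≤ ε := by
  -- Replacing `x` by `y` costs `ε / 4` for each of the two isometries; the remaining `ε / 2` is for
  -- the difference at `y`.
  obtain ⟨y, hyD, hy⟩ := hD.exists_dist_lt x (show 0 < ε / 4 by positivity)
  rw [dist_eq_norm] at hy
  have hT : 0 < |T| + 1 := by positivity
  obtain ⟨N, hN⟩ := Metric.cauchySeq_iff.1 (hk y hyD) (ε / 2 / (|T| + 1)) (by positivity)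
  refine ⟨N, fun n hn m hm t ht => ?_⟩
  have h1 := norm_exp_smul_sub_exp_smul_le (hK n) (hK m) (hcomm n m) t y
  have h2 := hN n hn m hm
  rw [dist_eq_norm] at h2
  have h3 : ‖K n y - K m y‖ * |t| ≤ ε / 2 := by
    have : |t| ≤ |T| + 1 := (ht.trans (le_abs_self T)).trans (by linarith)
    calc ‖K n y - K m y‖ * |t| ≤ (ε / 2 / (|T| + 1)) * (|T| + 1) := by gcongr
      _ = ε / 2 := by field_simp
  have h4 : NormedSpace.exp (t • K n) x - NormedSpace.exp (t • K m) x =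
      NormedSpace.exp (t • K n) (x - y) + (NormedSpace.exp (t • K n) y - NormedSpace.exp (t • K m) y)
        - NormedSpace.exp (t • K m) (x - y) := by
    simp only [map_sub]; abel
  rw [h4]
  refine (norm_sub_le _ _).trans ?_
  have h5 := norm_add_le (NormedSpace.exp (t • K n) (x - y))
    (NormedSpace.exp (t • K n) y - NormedSpace.exp (t • K m) y)
  rw [norm_exp_smul_apply (hK n)] at h5
  rw [norm_exp_smul_apply (hK m)]
  linarith

/-- The strong limit of unitary groups with commuting bounded generators that converge on a dense
subspace. -/
theorem exists_unitaryGroup_of_tendsto {K : ℕ → E →L[ℂ] E}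
    (hK : ∀ n, K n ∈ skewAdjoint (E →L[ℂ] E)) (hcomm : ∀ n m, Commute (K n) (K m))
    {D : Submodule ℂ E} (hD : Dense (D : Set E)) {k : D → E}
    (hk : ∀ x : D, Tendsto (fun n => K n x) atTop (𝓝 (k x))) :
    ∃ U : ℝ → E ≃ₗᵢ[ℂ] E, (∀ x, U 0 x = x) ∧ (∀ s t x, U (s + t) x = U s (U t x)) ∧
      (∀ x, Continuous fun t => U t x) ∧
      (∀ (x : D) (t : ℝ), HasDerivAt (fun s => U s (x : E)) (U t (k x)) t) ∧
      ∀ R : E →L[ℂ] E, (∀ n, Commute R (K n)) → ∀ t x, U t (R x) = R (U t x) := by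
  let +nondep : NormedAlgebra ℚ (E →L[ℂ] E) := .restrictScalars ℚ ℂ _
  have hc : ∀ (x : E) (T : ℝ) {ε : ℝ}, 0 < ε → ∃ N, ∀ n ≥ N, ∀ m ≥ N, ∀ t : ℝ, |t| ≤ T →
      ‖NormedSpace.exp (t • K n) x - NormedSpace.exp (t • K m) x‖ ≤ ε := fun x T ε hε =>
    uniform_cauchy_exp_smul hK hcomm hD (fun x hx => (hk ⟨x, hx⟩).cauchySeq) x T hε
  have hcs : ∀ (t : ℝ) (x : E), CauchySeq fun n => NormedSpace.exp (t • K n) x := fun t x => by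
    refine Metric.cauchySeq_iff.2 fun ε hε => ?_
    obtain ⟨N, hN⟩ := hc x |t| (half_pos hε)
    refine ⟨N, fun n hn m hm => ?_⟩
    rw [dist_eq_norm]
    linarith [hN n hn m hm t le_rfl]
  choose u hu using fun t x => cauchySeq_tendsto_of_complete (hcs t x)
  have hadd : ∀ s t x, u (s + t) x = u s (u t x) := fun s t x => by
    refine tendsto_nhds_unique (hu (s + t) x) ?_
    -- The isometries `exp (s K n)` do not enlarge the error made at time `t`, so the group law
    -- passes to the limit.
    have h1 : Tendsto (fun n => NormedSpace.exp (s • K n) (NormedSpace.exp (t • K n) x - u t x))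
        atTop (𝓝 0) := by
      refine tendsto_zero_iff_norm_tendsto_zero.2 ?_
      simp only [norm_exp_smul_apply (hK _)]
      exact tendsto_zero_iff_norm_tendsto_zero.1 (tendsto_sub_nhds_zero_iff.2 (hu t x))
    have h2 := h1.add (hu s (u t x))
    rw [zero_add] at h2
    refine h2.congr fun n => ?_
    have : Commute (s • K n) (t • K n) := ((Commute.refl (K n)).smul_left s).smul_right t
    rw [add_smul, NormedSpace.exp_add_of_commute this, mul_apply_eq_comp, map_sub,
      sub_add_cancel]
  have hzero : ∀ x, u 0 x = x := fun x => by
    refine tendsto_nhds_unique (hu 0 x) ?_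
    simp
  let lin : ℝ → E →ₗ[ℂ] E := fun t =>
    { toFun := u t
      map_add' := fun x y => tendsto_nhds_unique (hu t (x + y))
        (((hu t x).add (hu t y)).congr fun n => (map_add _ _ _).symm)
      map_smul' := fun c x => tendsto_nhds_unique (hu t (c • x))
        (((hu t x).const_smul c).congr fun n => (map_smul _ _ _).symm) }
  have hnorm : ∀ t x, ‖u t x‖ = ‖x‖ := fun t x => by
    refine tendsto_nhds_unique (hu t x).norm ?_
    simp only [norm_exp_smul_apply (hK _)]
    exact tendsto_const_nhds
  have hunif : ∀ (x : E) (T : ℝ), TendstoUniformlyOn (fun n t => NormedSpace.exp (t • K n) x)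
      (fun t => u t x) atTop (Metric.ball 0 T) := fun x T => by
    refine Metric.tendstoUniformlyOn_iff.2 fun ε hε => ?_
    obtain ⟨N, hN⟩ := hc x T (half_pos hε)
    filter_upwards [eventually_ge_atTop N] with n hn t ht
    have ht' : |t| ≤ T := by simpa using (mem_ball_zero_iff.1 ht).le
    have : ‖u t x - NormedSpace.exp (t • K n) x‖ ≤ ε / 2 :=
      le_of_tendsto ((hu t x).sub_const _).norm
        ((eventually_ge_atTop N).mono fun m hm => hN m hm n hn t ht')
    rw [dist_eq_norm]
    linarith
  let U : ℝ → E ≃ₗᵢ[ℂ] E := fun t =>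
    { LinearEquiv.ofLinearMap (re₁₂ := RingHomInvPair.ids) (re₂₁ := RingHomInvPair.ids) (lin t) (lin (-t))
        (LinearMap.ext fun x => by
          change u t (u (-t) x) = x
          rw [← hadd, add_neg_cancel, hzero])
        (LinearMap.ext fun x => by
          change u (-t) (u t x) = x
          rw [← hadd, neg_add_cancel, hzero]) with
      norm_map' := hnorm t }
  have hball : ∀ t : ℝ, Metric.ball (0 : ℝ) (|t| + 1) ∈ 𝓝 t := fun t =>
    Metric.isOpen_ball.mem_nhds (by simp)
  refine ⟨U, hzero, hadd, fun x => ?_, fun x t => ?_, fun R hR t x => ?_⟩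
  · refine continuous_iff_continuousAt.2 fun t => ?_
    have : ContinuousOn (fun t => u t x) (Metric.ball 0 (|t| + 1)) :=
      (hunif x (|t| + 1)).continuousOn (Frequently.of_forall fun n s _ =>
        (hasDerivAt_exp_smul_apply (K n) x s).continuousAt.continuousWithinAt)
    exact this.continuousAt (hball t)
  -- The derivatives converge locally uniformly: replacing `K n x` by `k x` costs `‖K n x - k x‖` at
  -- every time, and the groups converge uniformly at the fixed vector `k x`.
  · refine hasDerivAt_of_tendstoUniformlyOn (l := atTop) (f := fun n s => NormedSpace.exp (s • K n) (x : E))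
      (f' := fun n s => NormedSpace.exp (s • K n) (K n x)) (g' := fun s => u s (k x))
      (Metric.isOpen_ball (x := (0 : ℝ)) (ε := |t| + 1)) ?_
      (Eventually.of_forall fun n s _ => hasDerivAt_exp_smul_apply (K n) x s)
      (fun s _ => hu s x) (mem_of_mem_nhds (hball t))
    refine Metric.tendstoUniformlyOn_iff.2 fun ε hε => ?_
    filter_upwards [Metric.tendstoUniformlyOn_iff.1 (hunif (k x) (|t| + 1)) (ε / 2) (by positivity),
      Metric.tendsto_nhds.1 (hk x) (ε / 2) (by positivity)] with n h1 h2 s hs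
    have h3 := h1 s hs
    have h4 : dist (NormedSpace.exp (s • K n) (k x)) (NormedSpace.exp (s • K n) (K n x)) < ε / 2 := by
      rwa [dist_eq_norm, ← map_sub, norm_exp_smul_apply (hK n), ← dist_eq_norm, dist_comm]
    exact (dist_triangle _ _ _).trans_lt (by linarith)
  · refine tendsto_nhds_unique (hu t (R x)) ?_
    refine ((R.continuous.tendsto _).comp (hu t x)).congr fun n => ?_
    have : Commute R (NormedSpace.exp (t • K n)) := ((hR n).smul_right t).exp_right
    exact congrArg (fun f : E →L[ℂ] E => f x) this.eq

end UnitaryGroup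

/-! ### Resolvents at imaginary points -/

section Resolvent

variable {E : Type*} [NormedAddCommGroup E] [InnerProductSpace ℂ E] [CompleteSpace E]
  {A : E →ₗ.[ℂ] E}

theorem IsSelfAdjoint.inner_symm (hA : IsSelfAdjoint A) (x y : A.domain) :
    ⟪A x, (y : E)⟫_ℂ = ⟪(x : E), A y⟫_ℂ := by
  have h := LinearPMap.adjoint_isFormalAdjoint hA.dense_domain
  rw [LinearPMap.isSelfAdjoint_def.1 hA] at h
  exact h x y

/-- This is the part of self-adjointness beyond symmetry: the hypothesis puts `y` in the domain of
the adjoint, which is the domain of `A`. -/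
theorem IsSelfAdjoint.exists_apply_eq (hA : IsSelfAdjoint A) {y w : E}
    (h : ∀ x : A.domain, ⟪w, (x : E)⟫_ℂ = ⟪y, A x⟫_ℂ) : ∃ hy : y ∈ A.domain, A ⟨y, hy⟩ = w := by
  have h1 := LinearPMap.mem_adjoint_domain_of_exists y ⟨w, h⟩
  have h2 := LinearPMap.adjoint_apply_eq hA.dense_domain ⟨y, h1⟩ h
  generalize hB : LinearPMap.adjoint A = B at h1 h2
  obtain rfl : B = A := hB.symm.trans (LinearPMap.isSelfAdjoint_def.1 hA)
  exact ⟨h1, h2⟩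

/-- The cross term is the real part of `i r ⟨A x, x⟩`, and `⟨A x, x⟩` is real. -/
theorem IsSelfAdjoint.norm_add_smul_sq (hA : IsSelfAdjoint A) (r : ℝ) (x : A.domain) :
    ‖A x + (r * Complex.I : ℂ) • (x : E)‖ ^ 2 = ‖A x‖ ^ 2 + r ^ 2 * ‖(x : E)‖ ^ 2 := by
  have h1 : (⟪A x, (x : E)⟫_ℂ).im = 0 := by
    have h := hA.inner_symm x x
    rw [← inner_conj_symm] at h
    have := congrArg Complex.im h
    rw [Complex.conj_im] at this
    have h3 : (⟪A x, (x : E)⟫_ℂ).im = -(⟪(x : E), A x⟫_ℂ).im := by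
      rw [← inner_conj_symm, Complex.conj_im]
    linarith
  rw [norm_add_sq (𝕜 := ℂ), inner_smul_right, norm_smul]
  simp [h1, mul_pow]

/-- `R` is the inverse of `A + i r`, and its norm is at most `1 / |r|`. -/
structure IsImaginaryResolvent (A : E →ₗ.[ℂ] E) (r : ℝ) (R : E →L[ℂ] E) : Prop where
  shift_apply : ∀ y, ∃ h : R y ∈ A.domain, A ⟨R y, h⟩ + (r * Complex.I : ℂ) • R y = y
  apply_shift : ∀ x : A.domain, R (A x + (r * Complex.I : ℂ) • (x : E)) = x
  norm_le : ∀ y, |r| * ‖R y‖ ≤ ‖y‖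

/-- A self-adjoint operator has a resolvent at every nonzero imaginary point. -/
theorem IsSelfAdjoint.exists_resolvent (hA : IsSelfAdjoint A) {r : ℝ} (hr : r ≠ 0) :
    ∃ R : E →L[ℂ] E, IsImaginaryResolvent A r R := by
  have hr' : 0 < |r| := abs_pos.2 hr
  -- `q` is `A + i r` on the graph, which is complete because `A` is closed. Being bounded below,
  -- `q` is injective with closed range.
  let q : A.graph →L[ℂ] E := (ContinuousLinearMap.snd ℂ E E +
    (r * Complex.I : ℂ) • ContinuousLinearMap.fst ℂ E E) ∘L A.graph.subtypeL
  have hq : ∀ p : A.graph, ‖q p‖ ^ 2 = ‖p.1.2‖ ^ 2 + r ^ 2 * ‖p.1.1‖ ^ 2 := fun p => by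
    obtain ⟨x, hx1, hx2⟩ := (LinearPMap.mem_graph_iff A).1 p.2
    rw [← hx1, ← hx2, ← hA.norm_add_smul_sq r x, hx1, hx2]
    rfl
  have hq1 : ∀ p : A.graph, ‖p.1.2‖ ≤ ‖q p‖ := fun p => by
    refine le_of_sq_le_sq ?_ (norm_nonneg _)
    rw [hq]; nlinarith [mul_nonneg (sq_nonneg r) (sq_nonneg ‖p.1.1‖)]
  have hq2 : ∀ p : A.graph, |r| * ‖p.1.1‖ ≤ ‖q p‖ := fun p => by
    refine le_of_sq_le_sq ?_ (norm_nonneg _)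
    rw [hq, mul_pow, sq_abs]; nlinarith [sq_nonneg ‖p.1.2‖]
  have hcl : CompleteSpace A.graph := by
    have : IsClosed (A.graph : Set (E × E)) := hA.isClosed
    exact this.completeSpace_coe
  have hanti : AntilipschitzWith (Real.toNNReal (1 + |r|⁻¹)) q := by
    refine AddMonoidHomClass.antilipschitz_of_bound q fun p => ?_
    rw [Real.coe_toNNReal _ (by positivity)]
    change max ‖p.1.1‖ ‖p.1.2‖ ≤ (1 + |r|⁻¹) * ‖q p‖
    have h0 : 0 ≤ |r|⁻¹ * ‖q p‖ := by positivity
    refine max_le ?_ ((hq1 p).trans (by nlinarith [norm_nonneg (q p)]))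
    have : ‖p.1.1‖ ≤ |r|⁻¹ * ‖q p‖ := by
      rw [inv_mul_eq_div, le_div_iff₀ hr', mul_comm]; exact hq2 p
    nlinarith [norm_nonneg (q p)]
  have hrange : q.range = ⊤ := by
    have hc : IsClosed (q.range : Set E) := hanti.isClosed_range q.uniformContinuous
    have : CompleteSpace q.range := hc.completeSpace_coe
    refine Submodule.orthogonal_eq_bot_iff.1 ?_
    refine (Submodule.eq_bot_iff _).2 fun y hy => ?_
    -- A vector `y` orthogonal to the range satisfies `A y = i r y`. The norm identity for `-r` then
    -- forces `y = 0`.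
    have hy' : ∀ x : A.domain, ⟪(r * Complex.I : ℂ) • y, (x : E)⟫_ℂ = ⟪y, A x⟫_ℂ := fun x => by
      have h := (Submodule.mem_orthogonal' _ _).1 hy (q ⟨_, LinearPMap.mem_graph A x⟩) ⟨_, rfl⟩
      change ⟪y, A x + (r * Complex.I : ℂ) • (x : E)⟫_ℂ = 0 at h
      rw [inner_add_right, inner_smul_right] at h
      rw [inner_smul_left, eq_neg_of_add_eq_zero_left h]
      simp
    obtain ⟨hyD, hyA⟩ := hA.exists_apply_eq hy'
    have h := hA.norm_add_smul_sq (-r) ⟨y, hyD⟩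
    rw [hyA, Complex.ofReal_neg, neg_mul, neg_smul, add_neg_cancel, norm_zero] at h
    have h2 : r ^ 2 * ‖y‖ ^ 2 = 0 := by
      have : 0 ≤ r ^ 2 * ‖y‖ ^ 2 := by positivity
      nlinarith [sq_nonneg ‖(r * Complex.I : ℂ) • y‖]
    simpa [hr] using h2
  choose p hp using fun y : E => (show y ∈ q.range by rw [hrange]; trivial)
  have hpq : ∀ s, p (q s) = s := fun s => hanti.injective (hp (q s))
  let R : E →L[ℂ] E := LinearMap.mkContinuous
    { toFun := fun y => (p y).1.1
      map_add' := fun y z => by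
        have : p (y + z) = p y + p z := hanti.injective (by
          rw [map_add]; exact (hp _).trans (congrArg₂ _ (hp y).symm (hp z).symm))
        rw [this]; rfl
      map_smul' := fun c y => by
        have : p (c • y) = c • p y := hanti.injective (by
          rw [map_smul]; exact (hp _).trans (congrArg _ (hp y).symm))
        rw [this]; rfl } |r|⁻¹ fun y => by
      change ‖(p y).1.1‖ ≤ _
      have h := hq2 (p y)
      rw [show q (p y) = y from hp y] at h
      rw [inv_mul_eq_div, le_div_iff₀ hr', mul_comm]
      exact h
  refine ⟨R, fun y => ?_, fun x => ?_, fun y => ?_⟩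
  · obtain ⟨x, hx1, hx2⟩ := (LinearPMap.mem_graph_iff A).1 (p y).2
    have hx : R y = x := hx1.symm
    rw [hx]
    refine ⟨x.2, ?_⟩
    conv_rhs => rw [← hp y]
    change A x + _ = (p y).1.2 + (r * Complex.I : ℂ) • (p y).1.1
    rw [hx2, hx1]
  · change (p (q ⟨_, LinearPMap.mem_graph A x⟩)).1.1 = x
    rw [hpq]
  · have h := hq2 (p y)
    rw [show q (p y) = y from hp y] at h
    exact h

end Resolvent

/-! ### Yosida approximation, Stone's theorem and uniqueness of the evolution -/

section Schrodinger

variable {E : Type*} [NormedAddCommGroup E] [InnerProductSpace ℂ E]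
  {A : E →ₗ.[ℂ] E}

namespace IsImaginaryResolvent

variable {r s : ℝ} {R S : E →L[ℂ] E}

theorem adjoint_eq [CompleteSpace E] (hA : IsSelfAdjoint A) (hR : IsImaginaryResolvent A r R)
    (hS : IsImaginaryResolvent A (-r) S) : ContinuousLinearMap.adjoint R = S := by
  symm
  rw [ContinuousLinearMap.eq_adjoint_iff]
  intro v u
  obtain ⟨hx, hxu⟩ := hR.shift_apply u
  obtain ⟨hy, hyv⟩ := hS.shift_apply v
  conv_lhs => rw [← hxu]
  conv_rhs => rw [← hyv]
  rw [inner_add_left, inner_add_right, inner_smul_left, inner_smul_right,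
    ← hA.inner_symm ⟨S v, hy⟩ ⟨R u, hx⟩]
  simp

/-- The first resolvent identity. Its right side is antisymmetric in the scalar, so exchanging the
two points shows below that resolvents commute. -/
theorem sub_eq (hR : IsImaginaryResolvent A r R) (hS : IsImaginaryResolvent A s S) :
    R - S = (((s - r : ℝ) : ℂ) * Complex.I) • (R * S) := by
  ext v
  obtain ⟨hw, hwv⟩ := hS.shift_apply v
  have h := hR.apply_shift ⟨S v, hw⟩
  have hv : v = (A ⟨S v, hw⟩ + (r * Complex.I : ℂ) • S v)
      + (((s - r : ℝ) : ℂ) * Complex.I) • S v := by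
    rw [add_assoc, ← add_smul]
    conv_lhs => rw [← hwv]
    congr 2
    push_cast
    ring
  have hRv : R v = S v + (((s - r : ℝ) : ℂ) * Complex.I) • R (S v) := by
    conv_lhs => rw [hv]
    rw [map_add, h, map_smul]
  change R v - S v = (((s - r : ℝ) : ℂ) * Complex.I) • R (S v)
  rw [hRv, add_sub_cancel_left]

theorem commute (hR : IsImaginaryResolvent A r R) (hS : IsImaginaryResolvent A s S) :
    Commute R S := by
  have h1 := sub_eq hR hS
  have h2 := sub_eq hS hR
  by_cases hrs : s = r
  · rw [hrs] at h1
    simp only [sub_self, Complex.ofReal_zero, zero_mul, zero_smul, sub_eq_zero] at h1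
    rw [h1]
  · have hc : ((s - r : ℝ) : ℂ) * Complex.I ≠ 0 :=
      mul_ne_zero (Complex.ofReal_ne_zero.2 (sub_ne_zero.2 hrs)) Complex.I_ne_zero
    have h3 : (((s - r : ℝ) : ℂ) * Complex.I) • (R * S)
        = (((s - r : ℝ) : ℂ) * Complex.I) • (S * R) := by
      rw [← h1, ← neg_sub S R, h2, ← neg_smul]
      congr 1
      push_cast
      ring
    exact smul_right_injective _ hc h3

theorem smul_apply_eq (hR : IsImaginaryResolvent A r R) (x : A.domain) :
    (r * Complex.I : ℂ) • R x = x - R (A x) := by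
  have h := hR.apply_shift x
  rw [map_add, map_smul] at h
  exact eq_sub_of_add_eq' h

/-- In the sum of these identities for `r` and `-r` the terms in `x` cancel. What remains consists
of scaled resolvents applied to `A x`. -/
theorem sq_smul_apply_eq (hR : IsImaginaryResolvent A r R) (x : A.domain) :
    ((r : ℂ) ^ 2) • R x = -(r * Complex.I : ℂ) • (x : E) + (r * Complex.I : ℂ) • R (A x) := by
  have h : ((r : ℂ) ^ 2) = -(r * Complex.I) * (r * Complex.I) := by
    linear_combination ((r : ℂ) ^ 2) * Complex.I_sq
  rw [h, mul_smul, hR.smul_apply_eq, smul_sub, neg_smul, neg_smul, sub_neg_eq_add]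

/-- On the domain, `i ρ T x - x = -T (A x)` has norm at most `‖A x‖ / |ρ|`. The operators `i ρ T`
are contractions, so convergence extends from the dense domain to every vector. -/
theorem tendsto_smul_apply (hD : Dense (A.domain : Set E)) {ρ : ℕ → ℝ}
    (hρ : Tendsto (fun n => |ρ n|) atTop atTop) {T : ℕ → E →L[ℂ] E}
    (hT : ∀ n, IsImaginaryResolvent A (ρ n) (T n)) (z : E) :
    Tendsto (fun n => (ρ n * Complex.I : ℂ) • T n z) atTop (𝓝 z) := by
  have hbd : ∀ n y, ‖(ρ n * Complex.I : ℂ) • T n y‖ ≤ ‖y‖ := fun n y => by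
    rw [norm_smul]
    simpa using (hT n).norm_le y
  refine Metric.tendsto_atTop.2 fun ε hε => ?_
  obtain ⟨x, hxD, hx⟩ := hD.exists_dist_lt z (show 0 < ε / 3 by positivity)
  rw [dist_eq_norm] at hx
  obtain ⟨N, hN⟩ := eventually_atTop.1
    (hρ.eventually (eventually_gt_atTop (‖A ⟨x, hxD⟩‖ / (ε / 3))))
  refine ⟨N, fun n hn => ?_⟩
  have h1 := hN n hn
  have hpos : 0 < |ρ n| := lt_of_le_of_lt (by positivity) h1
  have h2 : ‖T n (A ⟨x, hxD⟩)‖ < ε / 3 := by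
    have := (hT n).norm_le (A ⟨x, hxD⟩)
    rw [div_lt_iff₀ (by positivity)] at h1
    by_contra hcon
    push Not at hcon
    nlinarith
  have h3 : (ρ n * Complex.I : ℂ) • T n z - z =
      (ρ n * Complex.I : ℂ) • T n (z - x) - (z - x) - T n (A ⟨x, hxD⟩) := by
    have := (hT n).smul_apply_eq ⟨x, hxD⟩
    rw [map_sub, smul_sub, this]
    abel
  rw [dist_eq_norm, h3]
  have h4 := norm_sub_le ((ρ n * Complex.I : ℂ) • T n (z - x) - (z - x)) (T n (A ⟨x, hxD⟩))
  have h5 := norm_sub_le ((ρ n * Complex.I : ℂ) • T n (z - x)) (z - x)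
  have h6 := hbd n (z - x)
  linarith

end IsImaginaryResolvent

variable [CompleteSpace E]

/-- Stone's theorem: a self-adjoint operator generates a Schrödinger evolution. -/
theorem IsSelfAdjoint.exists_isSchrodingerEvolution (hA : IsSelfAdjoint A) (hbar : ℝ) :
    ∃ U : ℝ → E ≃ₗᵢ[ℂ] E, IsSchrodingerEvolution hbar A U := by
  have hD := hA.dense_domain
  -- The shift by one keeps the resolvent point nonzero at `n = 0`.
  have hpos : ∀ n : ℕ, ((n : ℝ) + 1) ≠ 0 := fun n => by positivity
  choose R hR using fun n : ℕ => hA.exists_resolvent (hpos n)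
  choose S hS using fun n : ℕ => hA.exists_resolvent (neg_ne_zero.2 (hpos n))
  obtain ⟨Q, hQ⟩ := hA.exists_resolvent one_ne_zero
  -- With `r = n + 1`, this is formally `r² A / (A² + r²)`. Averaging the resolvents at `± i r`,
  -- which are adjoint to each other, makes it self-adjoint.
  let B : ℕ → E →L[ℂ] E := fun n => ((((n : ℝ) + 1 : ℝ) : ℂ) ^ 2 / 2) • (R n + S n)
  have hB : ∀ {L : E →L[ℂ] E}, (∀ n, Commute L (R n)) → (∀ n, Commute L (S n)) →
      ∀ n, Commute L (B n) := fun h1 h2 n => ((h1 n).add_right (h2 n)).smul_right _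
  have hBstar : ∀ n, star (B n) = B n := fun n => by
    have h1 : star (R n) = S n := (hR n).adjoint_eq hA (hS n)
    have h2 : star (S n) = R n := by rw [← h1, star_star]
    have h3 : star ((((n : ℝ) + 1 : ℝ) : ℂ) ^ 2 / 2) = (((n : ℝ) + 1 : ℝ) : ℂ) ^ 2 / 2 := by
      simp
    simp only [B]
    rw [star_smul, h3, star_add, h1, h2, add_comm (S n)]
  have habs : Tendsto (fun n : ℕ => |(n : ℝ) + 1|) atTop atTop :=
    tendsto_abs_atTop_atTop.comp (tendsto_atTop_add_const_right _ _ tendsto_natCast_atTop_atTop)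
  have hBlim : ∀ x : A.domain, Tendsto (fun n => B n x) atTop (𝓝 (A x)) := fun x => by
    have h1 := IsImaginaryResolvent.tendsto_smul_apply hD habs hR (A x)
    have h2 := IsImaginaryResolvent.tendsto_smul_apply hD (ρ := fun n : ℕ => -((n : ℝ) + 1))
      (by simpa only [abs_neg] using habs) hS (A x)
    have h3 := (h1.add h2).const_smul (2⁻¹ : ℂ)
    have h4 : (2⁻¹ : ℂ) • (A x + A x) = A x := by
      rw [← two_smul ℂ (A x), smul_smul]; norm_num
    rw [h4] at h3
    refine h3.congr fun n => ?_
    have h5 := (hR n).sq_smul_apply_eq x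
    have h6 := (hS n).sq_smul_apply_eq x
    change _ = ((((n : ℝ) + 1 : ℝ) : ℂ) ^ 2 / 2) • (R n x + S n x)
    rw [div_eq_inv_mul, mul_smul (2⁻¹ : ℂ), smul_add (_ ^ 2)]
    rw [Complex.ofReal_neg, neg_sq] at h6
    rw [h5, h6, Complex.ofReal_neg]
    congr 1
    simp only [neg_mul, neg_neg, neg_smul]
    abel
  let K : ℕ → E →L[ℂ] E := fun n => (-(Complex.I / (hbar : ℂ))) • B n
  have hK : ∀ n, K n ∈ skewAdjoint (E →L[ℂ] E) := fun n => by
    rw [skewAdjoint.mem_iff]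
    simp only [K]
    rw [star_smul, hBstar, ← neg_smul]
    congr 1
    simp [neg_div]
  have hRB : ∀ m n, Commute (R m) (B n) := fun m =>
    hB (fun n => (hR m).commute (hR n)) (fun n => (hR m).commute (hS n))
  have hSB : ∀ m n, Commute (S m) (B n) := fun m =>
    hB (fun n => (hS m).commute (hR n)) (fun n => (hS m).commute (hS n))
  have hcomm : ∀ n m, Commute (K n) (K m) := fun n m =>
    ((hB (fun k => (hRB k n).symm) (fun k => (hSB k n).symm) m).smul_left _).smul_right _
  obtain ⟨U, h0, hadd, hcont, hderiv, hUR⟩ := exists_unitaryGroup_of_tendsto hK hcomm hD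
    (k := fun x => (-(Complex.I / (hbar : ℂ))) • A x) (fun x => (hBlim x).const_smul _)
  refine ⟨U, h0, hadd, hcont, fun ψ t => ?_⟩
  -- Write `ψ = Q ((A + i) ψ)`. Since `U t` commutes with `Q`, the vector `U t ψ` lies in the range
  -- of `Q`, hence in the domain; applying `A + i` gives `A (U t ψ) = U t (A ψ)`.
  have hUQ := hUR Q (fun n => (hB (fun n => hQ.commute (hR n))
    (fun n => hQ.commute (hS n)) n).smul_right _) t (A ψ + (((1 : ℝ) : ℂ) * Complex.I) • (ψ : E))
  rw [hQ.apply_shift] at hUQ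
  obtain ⟨h, hsh⟩ := hQ.shift_apply (U t (A ψ + (((1 : ℝ) : ℂ) * Complex.I) • (ψ : E)))
  have hmem : U t (ψ : E) ∈ A.domain := by rw [hUQ]; exact h
  have hAU : A ⟨U t (ψ : E), hmem⟩ = U t (A ψ) := by
    have h7 : A ⟨U t (ψ : E), hmem⟩ + (((1 : ℝ) : ℂ) * Complex.I) • U t (ψ : E)
        = U t (A ψ + (((1 : ℝ) : ℂ) * Complex.I) • (ψ : E)) := by
      conv_rhs => rw [← hsh]
      congr 2
      exact Subtype.ext hUQ
    rw [map_add, map_smul] at h7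
    exact add_right_cancel h7
  refine ⟨hmem, ?_⟩
  rw [hAU, ← map_smul]
  exact hderiv ψ t

/-- Symmetry of `A` makes the inner product of two solutions of the Schrödinger equation
stationary, up to the effect of multiples of the states in their velocities. -/
theorem IsSelfAdjoint.hasDerivAt_inner_of_schrodinger (hA : IsSelfAdjoint A) {hbar : ℝ}
    {φ ψ : ℝ → E} {t : ℝ} {b c : ℂ} (hφ : φ t ∈ A.domain) (hψ : ψ t ∈ A.domain)
    (hφ' : HasDerivAt φ (-(Complex.I / (hbar : ℂ)) • A ⟨φ t, hφ⟩ + b • φ t) t)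
    (hψ' : HasDerivAt ψ (-(Complex.I / (hbar : ℂ)) • A ⟨ψ t, hψ⟩ + c • ψ t) t) :
    HasDerivAt (fun s => ⟪φ s, ψ s⟫_ℂ) (((starRingEnd ℂ) b + c) * ⟪φ t, ψ t⟫_ℂ) t := by
  refine (hφ'.inner ℂ hψ').congr_deriv ?_
  rw [inner_add_right, inner_add_left, inner_smul_right, inner_smul_right, inner_smul_left,
    inner_smul_left,
    hA.inner_symm ⟨φ t, hφ⟩ ⟨ψ t, hψ⟩]
  simp
  ring

/-- For `ψ` in the domain, `⟨U s ψ, V s ψ⟩` is constant, hence equal to `‖ψ‖²`. Equality in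
Cauchy–Schwarz for vectors of equal norm gives `U t ψ = V t ψ`, and density does the rest. -/
theorem IsSelfAdjoint.isSchrodingerEvolution_unique (hA : IsSelfAdjoint A) {hbar : ℝ}
    {U V : ℝ → E ≃ₗᵢ[ℂ] E} (hU : IsSchrodingerEvolution hbar A U)
    (hV : IsSchrodingerEvolution hbar A V) : U = V := by
  funext t
  refine LinearIsometryEquiv.ext fun ψ => ?_
  refine congrFun (Continuous.ext_on hA.dense_domain (U t).continuous (V t).continuous ?_) ψ
  intro ψ hψ
  have hd : ∀ s, HasDerivAt (fun s => ⟪U s ψ, V s ψ⟫_ℂ) 0 s := fun s => by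
    obtain ⟨h1, h1'⟩ := hU.schrodinger ⟨ψ, hψ⟩ s
    obtain ⟨h2, h2'⟩ := hV.schrodinger ⟨ψ, hψ⟩ s
    simpa using hA.hasDerivAt_inner_of_schrodinger (b := 0) (c := 0) h1 h2 (by simpa using h1') (by simpa using h2')
  have h := is_const_of_deriv_eq_zero (fun s => (hd s).differentiableAt) (fun s => (hd s).deriv) t 0
  simp only [hU.map_zero, hV.map_zero] at h
  have h2 := (inner_eq_norm_mul_iff (𝕜 := ℂ) (x := U t ψ) (y := V t ψ)).1 (by
    rw [h, inner_self_eq_norm_sq_to_K]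
    simp [sq])
  rcases eq_or_ne ψ 0 with rfl | h0
  · simp
  · simp only [LinearIsometryEquiv.norm_map] at h2
    exact (smul_right_injective E (by simpa using h0) h2)

end Schrodinger

/-! ### Calculus on projective space through representing vectors -/

namespace ProjectiveHilbert

section Geometry

variable {E : Type*} [NormedAddCommGroup E] [InnerProductSpace ℂ E]

theorem inner_baseVec_self [Nontrivial E] : ⟪baseVec E, baseVec E⟫_ℂ = 1 := by
  rw [inner_self_eq_norm_sq_to_K, norm_baseVec]; simp

theorem orthogonalProjectionOnto_baseVec :
    (ℂ ∙ baseVec E)ᗮ.orthogonalProjectionOnto (baseVec E) = 0 :=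
  Submodule.orthogonalProjectionOnto_orthogonal_apply_eq_zero
    (Submodule.mem_span_singleton_self _)

theorem eq_inner_smul_baseVec_add [Nontrivial E] (x : E) :
    x = ⟪baseVec E, x⟫_ℂ • baseVec E + ((ℂ ∙ baseVec E)ᗮ.orthogonalProjectionOnto x : E) := by
  have h := Submodule.starProjection_add_starProjection_orthogonal (K := (ℂ ∙ baseVec E)) x
  rw [Submodule.starProjection_unit_singleton ℂ (norm_baseVec E)] at h
  exact h.symm

theorem frameAt_baseVec_ne_zero (p : ℙ ℂ E) : frameAt p (baseVec E) ≠ 0 := by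
  have := nontrivial_of_point p
  simpa using frame_add_ne_zero (frameAt p) 0

theorem mk_frameAt_baseVec (p : ℙ ℂ E) :
    Projectivization.mk ℂ (frameAt p (baseVec E)) (frameAt_baseVec_ne_zero p) = p := by
  have h := frameAt_mem p
  rw [Projectivization.submodule_eq, Submodule.mem_span_singleton] at h
  conv_rhs => rw [← Projectivization.mk_rep p]
  exact (Projectivization.mk_eq_mk_iff' _ _ _ _ _).2 h

theorem inner_frameAt_symm_ne_zero {p : ℙ ℂ E} {ψ : E} {hψ : ψ ≠ 0}
    (h : Projectivization.mk ℂ ψ hψ = p) : ⟪baseVec E, (frameAt p).symm ψ⟫_ℂ ≠ 0 := by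
  rw [← mk_mem_coordSource _ ψ hψ, h]
  exact mem_coordSource_frameAt p

theorem frameAt_symm_eq_smul {p : ℙ ℂ E} {ψ : E} {hψ : ψ ≠ 0}
    (h : Projectivization.mk ℂ ψ hψ = p) :
    (frameAt p).symm ψ = ⟪baseVec E, (frameAt p).symm ψ⟫_ℂ • baseVec E := by
  have := nontrivial_of_point p
  have h1 := (Projectivization.mk_eq_mk_iff' ℂ _ _ hψ (frameAt_baseVec_ne_zero p)).1
    (h.trans (mk_frameAt_baseVec p).symm)
  obtain ⟨a, rfl⟩ := h1
  rw [map_smul, LinearIsometryEquiv.symm_apply_apply, inner_smul_right, inner_baseVec_self, mul_one]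

theorem coord_frameAt_self (p : ℙ ℂ E) : coord (frameAt p) p = 0 := by
  conv_lhs => rw [← mk_frameAt_baseVec p]
  rw [coord_mk, mk_frameAt_baseVec, LinearIsometryEquiv.symm_apply_apply, map_smul,
    orthogonalProjectionOnto_baseVec, smul_zero]

theorem eventually_mk_frameAt_coord [Nontrivial E] (p : ℙ ℂ E) :
    ∀ᶠ q in 𝓝 p, Projectivization.mk ℂ (frameAt p (baseVec E + (coord (frameAt p) q : E)))
      (frame_add_ne_zero _ _) = q := by
  filter_upwards [(isOpen_coordSource (frameAt p)).mem_nhds (mem_coordSource_frameAt p)] with q hq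
  exact (chart (frameAt p)).left_inv hq

theorem contMDiffAt_coord (p : ℙ ℂ E) :
    ContMDiffAt 𝓘(ℝ, Model E) 𝓘(ℝ, Model E) ∞ (coord (frameAt p)) p :=
  contMDiffAt_extChartAt (I := 𝓘(ℝ, Model E)) (x := p)

/-- The derivative of the affine section `v ↦ T (e + v)`. -/
noncomputable def sectionDeriv (p : ℙ ℂ E) : Model E →L[ℂ] E :=
  ((frameAt p).toContinuousLinearEquiv : E →L[ℂ] E) ∘L (ℂ ∙ baseVec E)ᗮ.subtypeL

section VectorValued

variable {V : Type*} {f : ℙ ℂ E → V} {g : E → V}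

/-- The affine section `v ↦ T (e + v)` inverts the chart, so near `p` any function of lines is its
lift composed with this section and the chart. -/
theorem eventuallyEq_comp_section [Nontrivial E]
    (hfg : ∀ ψ (hψ : ψ ≠ 0), f (Projectivization.mk ℂ ψ hψ) = g ψ) (p : ℙ ℂ E) :
    f =ᶠ[𝓝 p] fun q => g (frameAt p (baseVec E + (coord (frameAt p) q : E))) := by
  filter_upwards [eventually_mk_frameAt_coord p] with q hq
  conv_lhs => rw [← hq]
  rw [hfg]

variable [NormedAddCommGroup V] [NormedSpace ℝ V]

theorem contMDiffAt_of_lift (hfg : ∀ ψ (hψ : ψ ≠ 0), f (Projectivization.mk ℂ ψ hψ) = g ψ)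
    (p : ℙ ℂ E) (hg : ContDiffAt ℝ ∞ g (frameAt p (baseVec E))) :
    ContMDiffAt 𝓘(ℝ, Model E) 𝓘(ℝ, V) ∞ f p := by
  have := nontrivial_of_point p
  refine ContMDiffAt.congr_of_eventuallyEq ?_ (eventuallyEq_comp_section hfg p)
  have h1 : ContDiffAt ℝ ∞ (fun v : Model E => g (frameAt p (baseVec E + (v : E))))
      (coord (frameAt p) p) := by
    rw [coord_frameAt_self]
    refine ContDiffAt.comp (g := g) (0 : Model E) (by simpa using hg) ?_
    have : ContDiff ℂ ∞ (fun v : Model E => frameAt p (baseVec E + (v : E))) :=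
      (frameAt p).contDiff.comp (contDiff_const.add ((ℂ ∙ baseVec E)ᗮ.subtypeL.contDiff))
    exact (this.restrict_scalars ℝ).contDiffAt
  exact h1.contMDiffAt.comp p (contMDiffAt_coord p)

theorem hasMFDerivAt_of_lift (hfg : ∀ ψ (hψ : ψ ≠ 0), f (Projectivization.mk ℂ ψ hψ) = g ψ)
    (p : ℙ ℂ E) {g' : E →L[ℝ] V} (hg : HasFDerivAt g g' (frameAt p (baseVec E))) :
    HasMFDerivAt 𝓘(ℝ, Model E) 𝓘(ℝ, V) f p (g' ∘L (sectionDeriv p).restrictScalars ℝ) := by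
  have := nontrivial_of_point p
  refine ⟨?_, ?_⟩
  · refine ContinuousAt.congr ?_ (eventuallyEq_comp_section hfg p).symm
    refine ContinuousAt.comp (g := g) (by
      simpa [coord_frameAt_self] using hg.continuousAt) ?_
    exact (frameAt p).continuous.continuousAt.comp
      (continuousAt_const.add (continuous_subtype_val.continuousAt.comp
        (contMDiffAt_coord p).continuousAt))
  · have h0 : extChartAt 𝓘(ℝ, Model E) p p = (0 : Model E) := coord_frameAt_self p
    have h1 : writtenInExtChartAt 𝓘(ℝ, Model E) 𝓘(ℝ, V) p f =
        fun v : Model E => g (frameAt p (baseVec E + (v : E))) :=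
      funext fun v => hfg _ (frame_add_ne_zero (frameAt p) v)
    rw [h0, h1]
    have h2 : HasFDerivAt (𝕜 := ℂ) (fun v : Model E => frameAt p (baseVec E + (v : E)))
        (sectionDeriv p) 0 :=
      ((frameAt p).toContinuousLinearEquiv : E →L[ℂ] E).hasFDerivAt.comp (0 : Model E)
        ((ℂ ∙ baseVec E)ᗮ.subtypeL.hasFDerivAt.const_add (baseVec E))
    exact (HasFDerivAt.comp (g := g) (0 : Model E) (by simpa using hg)
      (h2.restrictScalars ℝ)).hasFDerivWithinAt

end VectorValued

/-- The affine coordinate, as a function of a representing vector. -/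
noncomputable def vecCoord (T : E ≃ₗᵢ[ℂ] E) (ψ : E) : Model E :=
  (ℂ ∙ baseVec E)ᗮ.orthogonalProjectionOnto ((⟪baseVec E, T.symm ψ⟫_ℂ)⁻¹ • T.symm ψ)

theorem contDiffAt_vecCoord (T : E ≃ₗᵢ[ℂ] E) {ψ : E} (h : ⟪baseVec E, T.symm ψ⟫_ℂ ≠ 0) :
    ContDiffAt ℝ ∞ (vecCoord T) ψ := by
  have h1 : ContDiff ℂ ∞ (fun v : E => T.symm v) := T.symm.contDiff
  have h2 : ContDiff ℂ ∞ (fun v : E => ⟪baseVec E, T.symm v⟫_ℂ) :=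
    (innerSL ℂ (baseVec E)).contDiff.comp h1
  exact ((ContinuousLinearMap.contDiff _).contDiffAt.comp ψ
    ((h2.contDiffAt.inv h).smul h1.contDiffAt)).restrict_scalars ℝ

/-- The derivative of the projection `E ∖ {0} → ℙ ℂ E` at a vector `ψ` on the line `p`, in the
preferred chart at `p`. -/
noncomputable def tangentProj (p : ℙ ℂ E) (ψ : E) : E →L[ℂ] Model E :=
  (⟪baseVec E, (frameAt p).symm ψ⟫_ℂ)⁻¹ • ((ℂ ∙ baseVec E)ᗮ.orthogonalProjectionOnto ∘L
    ((frameAt p).symm.toContinuousLinearEquiv : E →L[ℂ] E))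

theorem tangentProj_apply (p : ℙ ℂ E) (ψ u : E) :
    tangentProj p ψ u = (⟪baseVec E, (frameAt p).symm ψ⟫_ℂ)⁻¹ •
      (ℂ ∙ baseVec E)ᗮ.orthogonalProjectionOnto ((frameAt p).symm u) := rfl

/-- This homogeneity makes the Hamiltonian vector independent of the representing vector. -/
theorem tangentProj_smul (p : ℙ ℂ E) (ψ u : E) {c : ℂ} (hc : c ≠ 0) :
    tangentProj p (c • ψ) (c • u) = tangentProj p ψ u := by
  simp only [tangentProj_apply, map_smul, inner_smul_right, smul_smul, mul_inv]
  congr 1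
  field_simp

theorem tangentProj_self {p : ℙ ℂ E} {ψ : E} {hψ : ψ ≠ 0}
    (h : Projectivization.mk ℂ ψ hψ = p) : tangentProj p ψ ψ = 0 := by
  rw [tangentProj_apply, frameAt_symm_eq_smul h, map_smul, orthogonalProjectionOnto_baseVec,
    smul_zero, smul_zero]

theorem tangentProj_surjective {p : ℙ ℂ E} {ψ : E} {hψ : ψ ≠ 0}
    (h : Projectivization.mk ℂ ψ hψ = p) : Function.Surjective (tangentProj p ψ) := fun v => by
  refine ⟨⟪baseVec E, (frameAt p).symm ψ⟫_ℂ • frameAt p (v : E), ?_⟩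
  rw [map_smul, tangentProj_apply, LinearIsometryEquiv.symm_apply_apply,
    Submodule.orthogonalProjectionOnto_mem_subspace_eq_self, smul_smul,
    mul_inv_cancel₀ (inner_frameAt_symm_ne_zero h), one_smul]

/-- The horizontal lift of a tangent vector is a lift up to a multiple of the base point. -/
theorem frameAt_tangentProj (p : ℙ ℂ E) (ψ u : E) :
    ∃ b : ℂ, frameAt p (tangentProj p ψ u : E) =
      (⟪baseVec E, (frameAt p).symm ψ⟫_ℂ)⁻¹ • u + b • frameAt p (baseVec E) := by
  have := nontrivial_of_point p
  set c := ⟪baseVec E, (frameAt p).symm ψ⟫_ℂ with hc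
  refine ⟨-(c⁻¹ * ⟪baseVec E, (frameAt p).symm u⟫_ℂ), ?_⟩
  have h1 := congrArg (frameAt p) (eq_inner_smul_baseVec_add ((frameAt p).symm u))
  rw [LinearIsometryEquiv.apply_symm_apply, map_add, map_smul] at h1
  rw [tangentProj_apply, ← hc, Submodule.coe_smul, map_smul, ← sub_eq_of_eq_add' h1]
  module

/-- The product rule also differentiates the scalar factor, but that term is a multiple of `T.symm
ψ`, a multiple of `e`, which the projection to `eᗮ` kills. -/
theorem hasFDerivAt_vecCoord {p : ℙ ℂ E} {ψ : E} {hψ : ψ ≠ 0}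
    (h : Projectivization.mk ℂ ψ hψ = p) :
    HasFDerivAt (vecCoord (frameAt p)) ((tangentProj p ψ).restrictScalars ℝ) ψ := by
  set T := frameAt p with hT
  have hc0 := inner_frameAt_symm_ne_zero h
  have hc := frameAt_symm_eq_smul h
  have hd1 : HasFDerivAt (𝕜 := ℂ) (fun v : E => T.symm v)
      (T.symm.toContinuousLinearEquiv : E →L[ℂ] E) ψ :=
    (T.symm.toContinuousLinearEquiv : E →L[ℂ] E).hasFDerivAt
  have hd2 := ((innerSL ℂ (baseVec E)).hasFDerivAt (x := T.symm ψ)).comp ψ hd1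
  have hi := (hasDerivAt_inv (𝕜 := ℂ) (x := ⟪baseVec E, T.symm ψ⟫_ℂ) hc0).hasFDerivAt
  have hd3 := (hi.comp ψ hd2).smul hd1
  have hd4 := ((ℂ ∙ baseVec E)ᗮ.orthogonalProjectionOnto.hasFDerivAt).comp ψ hd3
  refine (hd4.restrictScalars ℝ).congr_fderiv ?_
  have hP : (ℂ ∙ baseVec E)ᗮ.orthogonalProjectionOnto (T.symm ψ) = 0 := by
    rw [hc, map_smul, orthogonalProjectionOnto_baseVec, smul_zero]
  ext u
  simp [hP, tangentProj_apply, ← hT]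

/-- The Fubini–Study form in the preferred chart. -/
theorem fubiniStudyForm_eq (hbar : ℝ) (p : ℙ ℂ E) (X Y : Model E) :
    fubiniStudyForm hbar p X Y = 2 * hbar * (⟪X, Y⟫_ℂ).im := by
  have := nontrivial_of_point p
  have h2 : ⟪(X : E), baseVec E⟫_ℂ = 0 := by
    rw [← inner_conj_symm, inner_baseVec_model, map_zero]
  change fubiniStudyLift hbar (frameAt p (baseVec E)) (frameAt p (X : E)) (frameAt p (Y : E)) = _
  unfold fubiniStudyLift
  simp only [LinearIsometryEquiv.inner_map_map, inner_baseVec_self, h2]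
  simp

theorem fubiniStudyForm_tangentProj (hbar : ℝ) {p : ℙ ℂ E} {ψ : E} {hψ : ψ ≠ 0}
    (h : Projectivization.mk ℂ ψ hψ = p) (u v : E) :
    fubiniStudyForm hbar p (tangentProj p ψ u) (tangentProj p ψ v) = fubiniStudyLift hbar ψ u v := by
  subst h
  rw [← fubiniStudyForm_mfderiv_proj hbar ⟨ψ, hψ⟩ u v,
    (hasMFDerivAt_proj ⟨ψ, hψ⟩ _ (frameAt_symm_eq_smul (hψ := hψ) rfl)).mfderiv]
  rfl

/-! ### Curves in projective space -/

/-- A differentiable curve of vectors projects to a differentiable curve of lines. -/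
theorem hasMFDerivAt_mk_curve {γ : ℝ → E} {γ' : E} {t : ℝ} (h0 : ∀ s, γ s ≠ 0)
    (hγ : HasDerivAt γ γ' t) {p : ℙ ℂ E} (hp : Projectivization.mk ℂ (γ t) (h0 t) = p) :
    HasMFDerivAt 𝓘(ℝ, ℝ) 𝓘(ℝ, Model E) (fun s => Projectivization.mk ℂ (γ s) (h0 s)) t
      ((1 : ℝ →L[ℝ] ℝ).smulRight (tangentProj p (γ t) γ')) := by
  subst hp
  refine ⟨?_, ?_⟩
  · exact continuous_mk.continuousAt.comp
      (f := fun s => (⟨γ s, h0 s⟩ : {v : E // v ≠ 0})) (hγ.continuousAt.codRestrict h0)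
  · have := (hasFDerivAt_vecCoord (hψ := h0 t) rfl).comp_hasDerivAt t hγ
    exact this.hasFDerivAt.hasFDerivWithinAt

/-- A differentiable curve of lines lifts, near any time, to a differentiable curve of vectors. -/
theorem exists_lift_of_hasMFDerivAt [Nontrivial E] {c : ℝ → ℙ ℂ E} {t : ℝ} {X : Model E}
    (hc : HasMFDerivAt 𝓘(ℝ, ℝ) 𝓘(ℝ, Model E) c t ((1 : ℝ →L[ℝ] ℝ).smulRight X)) :
    ∃ (γ : ℝ → E) (h0 : ∀ s, γ s ≠ 0), (∀ᶠ s in 𝓝 t, Projectivization.mk ℂ (γ s) (h0 s) = c s) ∧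
      γ t = frameAt (c t) (baseVec E) ∧ HasDerivAt γ (frameAt (c t) (X : E)) t := by
  refine ⟨fun s => frameAt (c t) (baseVec E + (coord (frameAt (c t)) (c s) : E)),
    fun s => frame_add_ne_zero _ _, ?_, ?_, ?_⟩
  · exact hc.1.eventually (eventually_mk_frameAt_coord (c t))
  · simp [coord_frameAt_self]
  · have h1 : HasDerivAt (fun s => coord (frameAt (c t)) (c s)) X t := by
      have h := hc.2
      rw [hasDerivAt_iff_hasFDerivAt]
      exact h.hasFDerivAt (by simp)
    have h2 : HasFDerivAt (𝕜 := ℂ) (fun v : Model E => frameAt (c t) (baseVec E + (v : E)))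
        (sectionDeriv (c t)) (coord (frameAt (c t)) (c t)) :=
      ((frameAt (c t)).toContinuousLinearEquiv : E →L[ℂ] E).hasFDerivAt.comp _
        ((ℂ ∙ baseVec E)ᗮ.subtypeL.hasFDerivAt.const_add (baseVec E))
    exact (h2.restrictScalars ℝ).comp_hasDerivAt t h1

end Geometry

end ProjectiveHilbert

/-! ### The projective domain and the expectation value -/

namespace ProjectiveHilbert

section Operator

variable {E : Type*} [NormedAddCommGroup E] [InnerProductSpace ℂ E] {A : E →ₗ.[ℂ] E}

variable (A) in
/-- The inclusion `D(A) → E` as a continuous map. -/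
noncomputable def Dom.inclL : Dom A →L[ℂ] E :=
  ⟨Dom.incl A, by
    change Continuous fun x : Dom A => (x : WithLp 2 (E × E)).fst
    fun_prop⟩

variable (A) in
/-- The operator `A` as a continuous map on its domain with the graph norm. -/
noncomputable def Dom.opL : Dom A →L[ℂ] E :=
  ⟨Dom.op A, by
    change Continuous fun x : Dom A => (x : WithLp 2 (E × E)).snd
    fun_prop⟩

/-- A vector of the domain as a point of the graph. -/
noncomputable def Dom.mk (ψ : A.domain) : Dom A :=
  ⟨WithLp.toLp 2 ((ψ : E), A ψ), LinearPMap.mem_graph A ψ⟩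

theorem Dom.incl_mk (ψ : A.domain) : Dom.incl A (Dom.mk ψ) = ψ := rfl

theorem Dom.mk_surjective : Function.Surjective (Dom.mk (A := A)) := fun φ => by
  obtain ⟨h, _⟩ := Dom.op_eq A φ
  exact ⟨⟨_, h⟩, Dom.incl_injective A rfl⟩

theorem Dom.incl_ne_zero {φ : Dom A} (hφ : φ ≠ 0) : Dom.incl A φ ≠ 0 := fun h =>
  hφ (Dom.incl_injective A (h.trans (map_zero _).symm))

theorem projIncl_mk (φ : Dom A) (hφ : φ ≠ 0) :
    projIncl A (Projectivization.mk ℂ φ hφ)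
      = Projectivization.mk ℂ (Dom.incl A φ) (Dom.incl_ne_zero hφ) := rfl

theorem mk_incl_frameAt (x : ℙ ℂ (Dom A)) :
    Projectivization.mk ℂ (Dom.incl A (frameAt x (baseVec (Dom A))))
      (Dom.incl_ne_zero (frameAt_baseVec_ne_zero x)) = projIncl A x := by
  rw [← projIncl_mk _ (frameAt_baseVec_ne_zero x), mk_frameAt_baseVec]

theorem continuous_projIncl : Continuous (projIncl A) := by
  refine continuous_coinduced_dom.2 ?_
  exact continuous_mk.comp (f := fun φ : {v : Dom A // v ≠ 0} =>
    (⟨Dom.incl A φ.1, Dom.incl_ne_zero φ.2⟩ : {v : E // v ≠ 0}))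
    (((Dom.inclL A).continuous.comp continuous_subtype_val).subtype_mk _)

/-- In the chart at the image point, the inclusion lifts to the smooth coordinate function after a
map that is bounded for the graph norm. -/
theorem contMDiff_projIncl :
    ContMDiff 𝓘(ℝ, Model (Dom A)) 𝓘(ℝ, Model E) ∞ (projIncl A) := fun x => by
  refine contMDiffAt_iff_target.2 ⟨continuous_projIncl.continuousAt, ?_⟩
  refine contMDiffAt_of_lift (f := fun y => coord (frameAt (projIncl A x)) (projIncl A y))
    (g := fun φ => vecCoord (frameAt (projIncl A x)) (Dom.inclL A φ)) (fun φ hφ => rfl) x ?_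
  exact (contDiffAt_vecCoord _ (inner_frameAt_symm_ne_zero (mk_incl_frameAt x))).comp _
    ((Dom.inclL A).contDiff.restrict_scalars ℝ).contDiffAt

theorem hasMFDerivAt_projIncl (x : ℙ ℂ (Dom A)) :
    HasMFDerivAt 𝓘(ℝ, Model (Dom A)) 𝓘(ℝ, Model E) (projIncl A) x
      ((tangentProj (projIncl A x) (Dom.incl A (frameAt x (baseVec (Dom A)))) ∘L Dom.inclL A ∘L
        sectionDeriv x).restrictScalars ℝ) := by
  refine ⟨continuous_projIncl.continuousAt, ?_⟩
  exact (hasMFDerivAt_of_lift (f := fun y => coord (frameAt (projIncl A x)) (projIncl A y))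
    (g := fun φ => vecCoord (frameAt (projIncl A x)) (Dom.inclL A φ)) (fun φ hφ => rfl) x
    ((hasFDerivAt_vecCoord (mk_incl_frameAt x)).comp _
      ((Dom.inclL A).hasFDerivAt.restrictScalars ℝ))).2

/-- The expectation value as a function of a vector in the domain. -/
noncomputable def vecExpectation (A : E →ₗ.[ℂ] E) (φ : Dom A) : ℝ :=
  (⟪Dom.incl A φ, Dom.op A φ⟫_ℂ / ⟪Dom.incl A φ, Dom.incl A φ⟫_ℂ).re

/-- The graph norm makes `A` bounded on its domain, so the quotient is smooth even for unbounded
`A`. -/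
theorem contDiffAt_vecExpectation {φ : Dom A} (hφ : φ ≠ 0) :
    ContDiffAt ℝ ∞ (vecExpectation A) φ := by
  have h1 : ContDiff ℝ ∞ (fun φ : Dom A => Dom.incl A φ) :=
    (Dom.inclL A).contDiff.restrict_scalars ℝ
  have h2 : ContDiff ℝ ∞ (fun φ : Dom A => Dom.op A φ) :=
    (Dom.opL A).contDiff.restrict_scalars ℝ
  have h3 := ((h1.inner ℂ h2).contDiffAt (x := φ)).mul (((h1.inner ℂ h1).contDiffAt (x := φ)).inv
    (inner_self_ne_zero.2 (Dom.incl_ne_zero hφ)))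
  refine (Complex.reCLM.contDiff.contDiffAt.comp φ h3).congr_of_eventuallyEq
    (Eventually.of_forall fun χ => ?_)
  exact congrArg Complex.re (div_eq_mul_inv _ _)

theorem contMDiff_expectation :
    ContMDiff 𝓘(ℝ, Model (Dom A)) 𝓘(ℝ, ℝ) ∞ (expectation A) := fun x =>
  contMDiffAt_of_lift (g := vecExpectation A) (fun _ _ => rfl) x
    (contDiffAt_vecExpectation (frameAt_baseVec_ne_zero x))

theorem dom_inner_symm [CompleteSpace E] (hA : IsSelfAdjoint A) (φ χ : Dom A) :
    ⟪Dom.op A φ, Dom.incl A χ⟫_ℂ = ⟪Dom.incl A φ, Dom.op A χ⟫_ℂ := by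
  obtain ⟨φ, rfl⟩ := Dom.mk_surjective φ
  obtain ⟨χ, rfl⟩ := Dom.mk_surjective χ
  exact hA.inner_symm φ χ

theorem denseRange_incl [CompleteSpace E] (hA : IsSelfAdjoint A) : DenseRange (Dom.incl A) := by
  refine hA.dense_domain.mono fun ψ hψ => ⟨Dom.mk ⟨ψ, hψ⟩, rfl⟩

/-- Along a line in the domain, the derivative of the expectation value is the pairing, under the
Fubini–Study form, with the generator of the Schrödinger evolution. -/
theorem hasDerivAt_vecExpectation [CompleteSpace E] (hA : IsSelfAdjoint A) {hbar : ℝ} (hbar_ne : hbar ≠ 0)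
    {φ : Dom A} (hφ : φ ≠ 0) (χ : Dom A) :
    HasDerivAt (fun s : ℝ => vecExpectation A (φ + s • χ))
      (fubiniStudyLift hbar (Dom.incl A φ) (-(Complex.I / (hbar : ℂ)) • Dom.op A φ)
        (Dom.incl A χ)) 0 := by
  have hline : ∀ L : Dom A →L[ℂ] E, HasDerivAt (fun s : ℝ => L (φ + s • χ)) (L χ) 0 := fun L => by
    have h1 : HasDerivAt (fun s : ℝ => φ + s • χ) χ 0 := by
      simpa using ((hasDerivAt_id (0 : ℝ)).smul_const χ).const_add φ
    exact (L.hasFDerivAt.restrictScalars ℝ).comp_hasDerivAt 0 h1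
  have hi : HasDerivAt (fun s : ℝ => Dom.incl A (φ + s • χ)) (Dom.incl A χ) 0 :=
    hline (Dom.inclL A)
  have ho : HasDerivAt (fun s : ℝ => Dom.op A (φ + s • χ)) (Dom.op A χ) 0 := hline (Dom.opL A)
  have hb : ⟪Dom.incl A φ, Dom.incl A φ⟫_ℂ ≠ 0 := inner_self_ne_zero.2 (Dom.incl_ne_zero hφ)
  have hq := (hi.inner ℂ ho).div (hi.inner ℂ hi) (by simpa using hb)
  have hre := Complex.reCLM.hasFDerivAt.comp_hasDerivAt (0 : ℝ) hq
  refine hre.congr_deriv ?_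
  have hac : (starRingEnd ℂ) ⟪Dom.incl A φ, Dom.op A φ⟫_ℂ = ⟪Dom.incl A φ, Dom.op A φ⟫_ℂ := by
    rw [inner_conj_symm, dom_inner_symm hA]
  have hbc : (starRingEnd ℂ) ⟪Dom.incl A φ, Dom.incl A φ⟫_ℂ = ⟪Dom.incl A φ, Dom.incl A φ⟫_ℂ :=
    inner_conj_symm _ _
  have h1 : ⟪Dom.incl A φ, Dom.op A χ⟫_ℂ = ⟪Dom.op A φ, Dom.incl A χ⟫_ℂ :=
    (dom_inner_symm hA φ χ).symm
  have h2 : ⟪Dom.incl A χ, Dom.op A φ⟫_ℂ = (starRingEnd ℂ) ⟪Dom.op A φ, Dom.incl A χ⟫_ℂ :=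
    (inner_conj_symm _ _).symm
  have h3 : ⟪Dom.incl A χ, Dom.incl A φ⟫_ℂ = (starRingEnd ℂ) ⟪Dom.incl A φ, Dom.incl A χ⟫_ℂ :=
    (inner_conj_symm _ _).symm
  have h4 : ⟪Dom.op A φ, Dom.incl A φ⟫_ℂ = ⟪Dom.incl A φ, Dom.op A φ⟫_ℂ := dom_inner_symm hA φ φ
  unfold fubiniStudyLift
  simp only [zero_smul, add_zero, inner_smul_left, h1, h2, h3, h4]
  set a := ⟪Dom.incl A φ, Dom.op A φ⟫_ℂ
  set b := ⟪Dom.incl A φ, Dom.incl A φ⟫_ℂ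
  set y := ⟪Dom.op A φ, Dom.incl A χ⟫_ℂ
  set z := ⟪Dom.incl A φ, Dom.incl A χ⟫_ℂ
  -- Symmetry of `A` reduces both sides to `Z`: the quotient rule gives `Z + conj Z`, and the form
  -- gives `2 ℏ Im (i Z / ℏ)`; both are `2 Re Z`.
  set Z := (y * b - a * z) / b ^ 2 with hZ
  have hh : (hbar : ℂ) ≠ 0 := Complex.ofReal_ne_zero.2 hbar_ne
  have hl : ((y + (starRingEnd ℂ) y) * b - a * (z + (starRingEnd ℂ) z)) / b ^ 2
      = Z + (starRingEnd ℂ) Z := by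
    rw [hZ, map_div₀, map_sub, map_mul, map_mul, map_pow, hac, hbc]
    ring
  have hr : ((starRingEnd ℂ) (-(Complex.I / (hbar : ℂ))) * y * b
      - (starRingEnd ℂ) (-(Complex.I / (hbar : ℂ))) * a * z) / b ^ 2
      = ((hbar⁻¹ : ℝ) : ℂ) * (Complex.I * Z) := by
    rw [hZ]
    simp only [map_neg, map_div₀, Complex.conj_I, Complex.conj_ofReal]
    push_cast
    field_simp
  rw [hl, hr, Complex.im_ofReal_mul, Complex.I_mul_im, Complex.reCLM_apply, Complex.add_re,
    Complex.conj_re]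
  field_simp
  ring

theorem mfderiv_expectation [CompleteSpace E] (hA : IsSelfAdjoint A) {hbar : ℝ} (hbar_ne : hbar ≠ 0)
    (x : ℙ ℂ (Dom A)) (v : Model (Dom A)) :
    mfderiv 𝓘(ℝ, Model (Dom A)) 𝓘(ℝ, ℝ) (expectation A) x v =
      fubiniStudyLift hbar (Dom.incl A (frameAt x (baseVec (Dom A))))
        (-(Complex.I / (hbar : ℂ)) • Dom.op A (frameAt x (baseVec (Dom A))))
        (Dom.incl A (sectionDeriv x v)) := by
  have h0 := frameAt_baseVec_ne_zero x
  have h1 : HasFDerivAt (vecExpectation A) _ (frameAt x (baseVec (Dom A))) :=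
    ((contDiffAt_vecExpectation h0).differentiableAt (by simp)).hasFDerivAt
  rw [(hasMFDerivAt_of_lift (f := expectation A) (fun _ _ => rfl) x h1).mfderiv]
  have h2 : HasDerivAt (fun s : ℝ => frameAt x (baseVec (Dom A)) + s • sectionDeriv x v)
      (sectionDeriv x v) 0 := by
    simpa using ((hasDerivAt_id (0 : ℝ)).smul_const (sectionDeriv x v)).const_add
      (frameAt x (baseVec (Dom A)))
  have h3 : HasDerivAt (fun s : ℝ => vecExpectation A
      (frameAt x (baseVec (Dom A)) + s • sectionDeriv x v))
      (fderiv ℝ (vecExpectation A) (frameAt x (baseVec (Dom A))) (sectionDeriv x v)) 0 :=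
    h1.comp_hasDerivAt_of_eq (0 : ℝ) h2 (by simp)
  exact h3.unique (hasDerivAt_vecExpectation hA hbar_ne h0 (sectionDeriv x v))

/-! ### The Hamiltonian vector field -/

variable (A) in
/-- The tangent vector `dπ (-i A ψ / ℏ)` at the line of `ψ`. -/
noncomputable def hamiltonianVector (hbar : ℝ) (x : ℙ ℂ (Dom A)) : Model E :=
  tangentProj (projIncl A x) (Dom.incl A (frameAt x (baseVec (Dom A))))
    (-(Complex.I / (hbar : ℂ)) • Dom.op A (frameAt x (baseVec (Dom A))))

theorem hamiltonianVector_mk (hbar : ℝ) (φ : Dom A) (hφ : φ ≠ 0) :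
    hamiltonianVector A hbar (Projectivization.mk ℂ φ hφ) =
      tangentProj (projIncl A (Projectivization.mk ℂ φ hφ)) (Dom.incl A φ)
        (-(Complex.I / (hbar : ℂ)) • Dom.op A φ) := by
  obtain ⟨a, ha⟩ := (Projectivization.mk_eq_mk_iff' ℂ _ _
    (frameAt_baseVec_ne_zero (Projectivization.mk ℂ φ hφ)) hφ).1 (mk_frameAt_baseVec _)
  have ha0 : a ≠ 0 := by
    rintro rfl
    rw [zero_smul] at ha
    exact frameAt_baseVec_ne_zero _ ha.symm
  unfold hamiltonianVector
  rw [← ha, (Dom.incl A).map_smul, (Dom.op A).map_smul, smul_comm _ a, tangentProj_smul _ _ _ ha0]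

theorem isHamiltonianVectorField_hamiltonianVector [CompleteSpace E] (hA : IsSelfAdjoint A) {hbar : ℝ}
    (hbar_ne : hbar ≠ 0) : IsHamiltonianVectorField hbar A (hamiltonianVector A hbar) :=
  fun x v => by
  rw [(hasMFDerivAt_projIncl x).mfderiv, mfderiv_expectation hA hbar_ne x v]
  exact fubiniStudyForm_tangentProj hbar (mk_incl_frameAt x) _ _

/-- The tangent space of `P(D(A))` is dense in that of `P(E)`. -/
theorem denseRange_mfderiv_projIncl [CompleteSpace E] (hA : IsSelfAdjoint A) (x : ℙ ℂ (Dom A)) :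
    DenseRange fun v : Model (Dom A) =>
      tangentProj (projIncl A x) (Dom.incl A (frameAt x (baseVec (Dom A))))
        (Dom.incl A (sectionDeriv x v)) := by
  have := nontrivial_of_point x
  have h := (tangentProj_surjective (mk_incl_frameAt x)).denseRange.comp (denseRange_incl hA)
    (tangentProj (projIncl A x) (Dom.incl A (frameAt x (baseVec (Dom A))))).continuous
  refine h.mono ?_
  rintro _ ⟨φ, rfl⟩
  -- Dropping the component of `φ` along the line `x` is harmless, since `tangentProj` kills
  -- multiples of the base point.
  refine ⟨(ℂ ∙ baseVec (Dom A))ᗮ.orthogonalProjectionOnto ((frameAt x).symm φ), ?_⟩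
  have h1 := congrArg (frameAt x) (eq_inner_smul_baseVec_add ((frameAt x).symm φ))
  rw [LinearIsometryEquiv.apply_symm_apply, map_add, map_smul] at h1
  simp only [Function.comp_apply]
  conv_rhs => rw [h1]
  rw [map_add, map_add, map_smul, map_smul, tangentProj_self (mk_incl_frameAt x), smul_zero,
    zero_add]
  rfl

/-- The form is `2 ℏ Im ⟨·, ·⟩` in the preferred chart, so the difference of two solutions is
orthogonal for `Im ⟨·, ·⟩` to a dense set of vectors, and by continuity to all. -/
theorem IsHamiltonianVectorField.eq_hamiltonianVector [CompleteSpace E] (hA : IsSelfAdjoint A) {hbar : ℝ}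
    (hbar_ne : hbar ≠ 0) {X : (x : ℙ ℂ (Dom A)) → TangentSpace 𝓘(ℝ, Model E) (projIncl A x)}
    (hX : IsHamiltonianVectorField hbar A X) : X = hamiltonianVector A hbar := by
  funext x
  have hY := isHamiltonianVectorField_hamiltonianVector hA hbar_ne
  let X' : Model E := X x
  let Y' : Model E := hamiltonianVector A hbar x
  have h1 : ∀ v : Model (Dom A), (⟪X' - Y',
      tangentProj (projIncl A x) (Dom.incl A (frameAt x (baseVec (Dom A))))
        (Dom.incl A (sectionDeriv x v))⟫_ℂ).im = 0 := fun v => by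
    have h := (hX x v).trans (hY x v).symm
    rw [(hasMFDerivAt_projIncl x).mfderiv] at h
    have h' := (fubiniStudyForm_eq hbar (projIncl A x) X' _).symm.trans
      (h.trans (fubiniStudyForm_eq hbar (projIncl A x) Y' _))
    rw [inner_sub_left, Complex.sub_im, sub_eq_zero]
    exact mul_left_cancel₀ (mul_ne_zero two_ne_zero hbar_ne) h'
  have h2 := (denseRange_mfderiv_projIncl hA x).equalizer
    (g := fun w : Model E => (⟪X' - Y', w⟫_ℂ).im) (h := fun _ => (0 : ℝ))
    (Complex.continuous_im.comp (by fun_prop)) continuous_const (funext h1)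
  -- Testing against `i` times the difference turns the imaginary part into the squared norm.
  have h3 := congrFun h2 (Complex.I • (X' - Y'))
  simp only [inner_smul_right, Complex.I_mul_im] at h3
  have h4 : X' - Y' = 0 := by
    have : RCLike.re ⟪X' - Y', X' - Y'⟫_ℂ = 0 := h3
    rwa [inner_self_eq_norm_sq, sq_eq_zero_iff, norm_eq_zero] at this
  exact sub_eq_zero.1 h4

end Operator

end ProjectiveHilbert

/-! ### The overlap function and the Hausdorff property -/

namespace ProjectiveHilbert

section Overlap

variable {E : Type*} [NormedAddCommGroup E] [InnerProductSpace ℂ E]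

/-- The squared norm `‖⟨χ, ψ⟩‖² / ‖ψ‖²` of the projection of `χ` to the line of `ψ`. -/
noncomputable def overlap (χ : E) (p : ℙ ℂ E) : ℝ :=
  p.lift (fun ψ => Complex.normSq ⟪χ, ψ.1⟫_ℂ / (⟪ψ.1, ψ.1⟫_ℂ).re) (by
    rintro ⟨a, ha⟩ ⟨b, hb⟩ t rfl
    have ht : Complex.normSq t ≠ 0 := by
      rw [Ne, Complex.normSq_eq_zero]; rintro rfl; simp at ha
    have h : (⟪t • b, t • b⟫_ℂ).re = Complex.normSq t * (⟪b, b⟫_ℂ).re := by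
      rw [inner_smul_left, inner_smul_right, ← mul_assoc, ← Complex.normSq_eq_conj_mul_self,
        Complex.re_ofReal_mul]
    change Complex.normSq ⟪χ, t • b⟫_ℂ / (⟪t • b, t • b⟫_ℂ).re = _
    rw [h, inner_smul_right, map_mul, mul_div_mul_left _ _ ht])

theorem overlap_mk (χ ψ : E) (hψ : ψ ≠ 0) :
    overlap χ (Projectivization.mk ℂ ψ hψ) = Complex.normSq ⟪χ, ψ⟫_ℂ / (⟪ψ, ψ⟫_ℂ).re := rfl

theorem inner_self_re_pos {ψ : E} (hψ : ψ ≠ 0) : 0 < (⟪ψ, ψ⟫_ℂ).re := by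
  have h : (⟪ψ, ψ⟫_ℂ).re = ‖ψ‖ ^ 2 := inner_self_eq_norm_sq (𝕜 := ℂ) ψ
  rw [h]
  have := norm_pos_iff.2 hψ
  positivity

theorem continuous_overlap (χ : E) : Continuous (overlap χ) := by
  refine continuous_coinduced_dom.2 ?_
  change Continuous fun ψ : {v : E // v ≠ 0} => Complex.normSq ⟪χ, ψ.1⟫_ℂ / (⟪ψ.1, ψ.1⟫_ℂ).re
  exact (Complex.continuous_normSq.comp (by fun_prop)).div
    (Complex.continuous_re.comp (by fun_prop)) fun ψ => (inner_self_re_pos ψ.2).ne'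

theorem overlap_self {χ : E} (hχ : χ ≠ 0) :
    overlap χ (Projectivization.mk ℂ χ hχ) = ‖χ‖ ^ 2 := by
  have h : (⟪χ, χ⟫_ℂ).re = ‖χ‖ ^ 2 := inner_self_eq_norm_sq (𝕜 := ℂ) χ
  have h0 := norm_ne_zero_iff.2 hχ
  rw [overlap_mk, h, Complex.normSq_eq_norm_sq, inner_self_eq_norm_sq_to_K, norm_pow,
    RCLike.norm_ofReal, abs_norm]
  field_simp

/-- The equality case of the Cauchy–Schwarz inequality. -/
theorem eq_mk_of_overlap_eq {χ : E} (hχ : χ ≠ 0) {p : ℙ ℂ E} (h : overlap χ p = ‖χ‖ ^ 2) :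
    p = Projectivization.mk ℂ χ hχ := by
  induction p using Projectivization.ind with
  | h ψ hψ =>
    have hn : (⟪ψ, ψ⟫_ℂ).re = ‖ψ‖ ^ 2 := inner_self_eq_norm_sq (𝕜 := ℂ) ψ
    have h0 := norm_pos_iff.2 hψ
    rw [overlap_mk, hn, Complex.normSq_eq_norm_sq, div_eq_iff (by positivity), ← mul_pow] at h
    have h1 : ‖⟪χ, ψ⟫_ℂ‖ = ‖χ‖ * ‖ψ‖ := (sq_eq_sq₀ (norm_nonneg _) (by positivity)).1 h
    obtain ⟨r, hr, hrψ⟩ := (norm_inner_eq_norm_iff hχ hψ).1 h1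
    exact (Projectivization.mk_eq_mk_iff' ℂ _ _ _ _).2 ⟨r, hrψ.symm⟩

/-- The overlap with a vector on `p` is continuous and takes its maximal value only at `p`, so it
separates `p` from any other line. -/
instance instT2Space : T2Space (ℙ ℂ E) := by
  refine ⟨fun p q hpq => ?_⟩
  refine separated_by_continuous (continuous_overlap p.rep) fun h => hpq ?_
  have hp : overlap p.rep p = ‖p.rep‖ ^ 2 := by
    conv_lhs => rw [← Projectivization.mk_rep p]
    conv_rhs => rw [← overlap_self p.rep_nonzero]
    rw [Projectivization.mk_rep]
  rw [hp] at h
  rw [eq_mk_of_overlap_eq p.rep_nonzero h.symm, Projectivization.mk_rep]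

end Overlap

/-! ### Trajectories, and the flow as projected Schrödinger evolution -/

section Trajectory

variable {E : Type*} [NormedAddCommGroup E] [InnerProductSpace ℂ E]
  {A : E →ₗ.[ℂ] E} {hbar : ℝ}

/-- A trajectory of the Hamiltonian vector field lifts, near any time, to a solution of the
Schrödinger equation up to a time-dependent multiple of the state. -/
theorem exists_lift_of_isTrajectoryOn {c : ℝ → ℙ ℂ (Dom A)} {J : Set ℝ}
    (hc : IsTrajectoryOn A (hamiltonianVector A hbar) c J) {t : ℝ} (ht : t ∈ J) :
    ∃ (γ : ℝ → E) (h0 : ∀ s, γ s ≠ 0) (hγ : γ t ∈ A.domain) (b : ℂ),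
      (∀ᶠ s in 𝓝 t, Projectivization.mk ℂ (γ s) (h0 s) = projIncl A (c s)) ∧
      HasDerivAt γ (-(Complex.I / (hbar : ℂ)) • A ⟨γ t, hγ⟩ + b • γ t) t := by
  have := nontrivial_of_point (projIncl A (c t))
  obtain ⟨γ, h0, hev, hγt, hγ'⟩ := exists_lift_of_hasMFDerivAt (hc t ht)
  have hφ0 := frameAt_baseVec_ne_zero (c t)
  set φ := frameAt (c t) (baseVec (Dom A)) with hφ
  have h1 : Projectivization.mk ℂ (Dom.incl A φ) (Dom.incl_ne_zero hφ0) = projIncl A (c t) :=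
    mk_incl_frameAt (c t)
  set a := ⟪baseVec E, (frameAt (projIncl A (c t))).symm (Dom.incl A φ)⟫_ℂ with ha
  have ha0 : a ≠ 0 := inner_frameAt_symm_ne_zero h1
  -- The lift starts from the frame vector at the image line, whereas the field is given by the
  -- frame of `Dom A`. Both vectors span the same line, so `γ t` lies in the domain.
  have h2 : γ t = a⁻¹ • Dom.incl A φ := by
    have h := congrArg (frameAt (projIncl A (c t))) (frameAt_symm_eq_smul h1)
    rw [LinearIsometryEquiv.apply_symm_apply, map_smul, ← ha] at h
    rw [hγt, h, inv_smul_smul₀ ha0]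
  obtain ⟨hmem, hop⟩ := Dom.op_eq A (a⁻¹ • φ)
  rw [map_smul] at hmem
  have hγmem : γ t ∈ A.domain := by rw [h2]; exact hmem
  have hAγ : A ⟨γ t, hγmem⟩ = a⁻¹ • Dom.op A φ := by
    rw [← map_smul, hop]
    congr 1
    exact Subtype.ext (h2.trans (map_smul _ _ _).symm)
  obtain ⟨b, hb⟩ := frameAt_tangentProj (projIncl A (c t)) (Dom.incl A φ)
    (-(Complex.I / (hbar : ℂ)) • Dom.op A φ)
  refine ⟨γ, h0, hγmem, b, hev, hγ'.congr_deriv ?_⟩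
  rw [hAγ, hγt, smul_comm _ a⁻¹]
  exact hb

theorem projUnitary_mk (T : E ≃ₗᵢ[ℂ] E) (ψ : E) (hψ : ψ ≠ 0) :
    projUnitary T (Projectivization.mk ℂ ψ hψ)
      = Projectivization.mk ℂ (T ψ) (T.map_eq_zero_iff.not.2 hψ) := rfl

/-- Along a trajectory, the overlap with a solution of the Schrödinger equation is constant. -/
theorem hasDerivAt_overlap_of_isTrajectoryOn [CompleteSpace E] (hA : IsSelfAdjoint A) {U : ℝ → E ≃ₗᵢ[ℂ] E}
    (hU : IsSchrodingerEvolution hbar A U) {c : ℝ → ℙ ℂ (Dom A)} {J : Set ℝ}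
    (hc : IsTrajectoryOn A (hamiltonianVector A hbar) c J) (ψ : A.domain) {t : ℝ} (ht : t ∈ J) :
    HasDerivAt (fun s => overlap (U s (ψ : E)) (projIncl A (c s))) 0 t := by
  obtain ⟨γ, h0, hγ, b, hev, hγ'⟩ := exists_lift_of_isTrajectoryOn hc ht
  obtain ⟨hUψ, hU'⟩ := hU.schrodinger ψ t
  have h1 : HasDerivAt (fun s => ⟪U s (ψ : E), γ s⟫_ℂ) (b * ⟪U t (ψ : E), γ t⟫_ℂ) t := by
    simpa using hA.hasDerivAt_inner_of_schrodinger (b := 0) hUψ hγ (by simpa using hU') hγ'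
  have h2 := hA.hasDerivAt_inner_of_schrodinger hγ hγ hγ' hγ'
  have h3 : HasDerivAt (fun s => Complex.normSq ⟪U s (ψ : E), γ s⟫_ℂ)
      (2 * b.re * Complex.normSq ⟪U t (ψ : E), γ t⟫_ℂ) t := by
    have h := h1.norm_sq
    simp only [← Complex.normSq_eq_norm_sq] at h
    refine h.congr_deriv ?_
    simp only [Complex.inner, Complex.normSq_apply, Complex.mul_re, Complex.mul_im, Complex.conj_re,
      Complex.conj_im]
    ring
  have h4 : HasDerivAt (fun s => (⟪γ s, γ s⟫_ℂ).re) (2 * b.re * (⟪γ t, γ t⟫_ℂ).re) t := by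
    refine (Complex.reCLM.hasFDerivAt.comp_hasDerivAt t h2).congr_deriv ?_
    rw [Complex.reCLM_apply, show (starRingEnd ℂ) b + b = ((2 * b.re : ℝ) : ℂ) by
      rw [add_comm, Complex.add_conj], Complex.re_ofReal_mul]
  -- Numerator and denominator change at the same relative rate `2 Re b`, so their quotient is
  -- stationary.
  have h5 := h3.div h4 (inner_self_re_pos (h0 t)).ne'
  refine (h5.congr_deriv ?_).congr_of_eventuallyEq ?_
  · ring
  · filter_upwards [hev] with s hs
    rw [← hs, overlap_mk]
    rfl

/-- The lifts exist only locally and vary with the time, but the overlap lives on projective space,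
so its vanishing derivative makes it constant on all of `J`. -/
theorem eq_projUnitary_of_isTrajectoryOn [CompleteSpace E] (hA : IsSelfAdjoint A) {U : ℝ → E ≃ₗᵢ[ℂ] E}
    (hU : IsSchrodingerEvolution hbar A U) {c : ℝ → ℙ ℂ (Dom A)} {J : Set ℝ} (hJ : IsOpen J)
    (hJc : J.OrdConnected) (h0 : 0 ∈ J)
    (hc : IsTrajectoryOn A (hamiltonianVector A hbar) c J) {t : ℝ} (ht : t ∈ J) :
    projIncl A (c t) = projUnitary (U t) (projIncl A (c 0)) := by
  obtain ⟨φ, hφ, hφc⟩ : ∃ (φ : Dom A) (hφ : φ ≠ 0), Projectivization.mk ℂ φ hφ = c 0 :=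
    ⟨_, (c 0).rep_nonzero, (c 0).mk_rep⟩
  obtain ⟨ψ, rfl⟩ := Dom.mk_surjective φ
  have hψ0 : (ψ : E) ≠ 0 := Dom.incl_ne_zero hφ
  have hc0 : projIncl A (c 0) = Projectivization.mk ℂ (ψ : E) hψ0 := by rw [← hφc]; rfl
  have hd := fun s hs => hasDerivAt_overlap_of_isTrajectoryOn hA hU hc ψ (t := s) hs
  have h := hJ.is_const_of_deriv_eq_zero hJc.isPreconnected
    (fun s hs => (hd s hs).differentiableAt.differentiableWithinAt)
    (fun s hs => (hd s hs).deriv) ht h0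
  -- The overlap at time `t` is the initial one, `‖ψ‖² = ‖U t ψ‖²`: the equality case of
  -- Cauchy–Schwarz.
  rw [hU.map_zero, hc0, overlap_self, ← (U t).norm_map] at h
  rw [hc0, projUnitary_mk]
  exact eq_mk_of_overlap_eq _ h

/-- The projected Schrödinger evolution of a line in the domain is a trajectory. -/
theorem exists_isTrajectoryOn_projUnitary {U : ℝ → E ≃ₗᵢ[ℂ] E}
    (hU : IsSchrodingerEvolution hbar A U) (x : ℙ ℂ (Dom A)) :
    ∃ c : ℝ → ℙ ℂ (Dom A), (∀ t, projIncl A (c t) = projUnitary (U t) (projIncl A x)) ∧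
      IsTrajectoryOn A (hamiltonianVector A hbar) c Set.univ := by
  induction x using Projectivization.ind with
  | h φ hφ =>
    obtain ⟨ψ, rfl⟩ := Dom.mk_surjective φ
    have hψ0 : (ψ : E) ≠ 0 := Dom.incl_ne_zero hφ
    choose hmem hderiv using hU.schrodinger ψ
    have hne : ∀ t, U t (ψ : E) ≠ 0 := fun t => (U t).map_eq_zero_iff.not.2 hψ0
    have hφne : ∀ t, Dom.mk ⟨U t (ψ : E), hmem t⟩ ≠ 0 := fun t h =>
      hne t ((Dom.incl_mk ⟨U t (ψ : E), hmem t⟩).symm.trans (by rw [h, map_zero]))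
    refine ⟨fun t => Projectivization.mk ℂ (Dom.mk ⟨U t (ψ : E), hmem t⟩) (hφne t),
      fun t => rfl, fun t _ => ?_⟩
    have h := hasMFDerivAt_mk_curve hne (hderiv t) rfl
    rw [hamiltonianVector_mk]
    exact h

/-- Strong continuity and the uniform Lipschitz constant 1 give joint continuity on vectors. Local
affine sections carry it to lines, which avoids asking whether the product with `ℝ` is again a
quotient map. -/
theorem continuous_projUnitary {U : ℝ → E ≃ₗᵢ[ℂ] E} (hU : ∀ ψ, Continuous fun t => U t ψ) :
    Continuous fun q : ℝ × ℙ ℂ E => projUnitary (U q.1) q.2 := by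
  have hcont : Continuous fun q : ℝ × E => U q.1 q.2 :=
    continuous_prod_of_continuous_lipschitzWith' _ 1 (fun t => (U t).lipschitz) hU
  refine continuous_iff_continuousAt.2 fun ⟨t, p⟩ => ?_
  have := nontrivial_of_point p
  have hne : ∀ q : ℝ × ℙ ℂ E,
      U q.1 (frameAt p (baseVec E + (coord (frameAt p) q.2 : E))) ≠ 0 := fun q =>
    (U q.1).map_eq_zero_iff.not.2 (frame_add_ne_zero _ _)
  have h1 : ContinuousAt (fun q : ℝ × ℙ ℂ E =>
      U q.1 (frameAt p (baseVec E + (coord (frameAt p) q.2 : E)))) (t, p) := by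
    refine hcont.continuousAt.comp (f := fun q : ℝ × ℙ ℂ E =>
      (q.1, frameAt p (baseVec E + (coord (frameAt p) q.2 : E)))) (continuousAt_fst.prodMk ?_)
    exact (frameAt p).continuous.continuousAt.comp (continuousAt_const.add
      (continuous_subtype_val.continuousAt.comp
        ((contMDiffAt_coord p).continuousAt.comp continuousAt_snd)))
  have h2 := continuous_mk.continuousAt.comp (h1.codRestrict hne)
  refine h2.congr ?_
  filter_upwards [continuousAt_snd.eventually (eventually_mk_frameAt_coord p)] with q hq
  conv_rhs => rw [← hq]
  rfl

/-- An open set of lines pulls back to an open set of nonzero vectors, which meets the dense domain.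
-/
theorem denseRange_projIncl [CompleteSpace E] (hA : IsSelfAdjoint A) : DenseRange (projIncl A) := by
  refine dense_iff_inter_open.2 fun O hO ⟨p, hp⟩ => ?_
  induction p using Projectivization.ind with
  | h ψ hψ =>
    obtain ⟨W, hW, hWO⟩ := isOpen_induced_iff.1 (hO.preimage continuous_mk)
    have hψW : ψ ∈ W := by
      have : (⟨ψ, hψ⟩ : {v : E // v ≠ 0}) ∈ Subtype.val ⁻¹' W := by rw [hWO]; exact hp
      exact this
    obtain ⟨φ, hφW, hφ0⟩ := (denseRange_incl hA).exists_mem_open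
      (hW.inter isOpen_compl_singleton) ⟨ψ, hψW, hψ⟩
    have hφ : φ ≠ 0 := by rintro rfl; exact hφ0 (map_zero _)
    refine ⟨_, ?_, Projectivization.mk ℂ φ hφ, rfl⟩
    have : (⟨Dom.incl A φ, hφ0⟩ : {v : E // v ≠ 0}) ∈ Subtype.val ⁻¹' W := hφW
    rw [hWO] at this
    exact this

/-- The projected Schrödinger evolution is the only flow of the Hamiltonian vector field. -/
theorem isFlowOf_hamiltonianVector_iff [CompleteSpace E] (hA : IsSelfAdjoint A) {U : ℝ → E ≃ₗᵢ[ℂ] E}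
    (hU : IsSchrodingerEvolution hbar A U) (Φ : ℝ → ℙ ℂ E → ℙ ℂ E) :
    IsFlowOf A (hamiltonianVector A hbar) Φ ↔ Φ = fun t => projUnitary (U t) := by
  have hcont := continuous_projUnitary hU.continuous
  constructor
  · intro hΦ
    funext t
    -- At a fixed time both sides are continuous into a Hausdorff space, so agreement on the dense
    -- `P(D)` suffices; there it is uniqueness of trajectories.
    refine (denseRange_projIncl hA).equalizer (hΦ.continuous.comp (Continuous.prodMk_right t))
      (hcont.comp (Continuous.prodMk_right t)) (funext fun x => ?_)
    obtain ⟨c, hcΦ, hc⟩ := hΦ.integralCurve x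
    have h := eq_projUnitary_of_isTrajectoryOn hA hU isOpen_univ Set.ordConnected_univ
      (Set.mem_univ _) hc (Set.mem_univ t)
    rw [hcΦ, hcΦ, hΦ.map_zero] at h
    exact h
  · rintro rfl
    refine ⟨fun p => ?_, fun s t p => ?_, hcont, exists_isTrajectoryOn_projUnitary hU⟩
    · induction p using Projectivization.ind with
      | h ψ hψ => simp only [projUnitary_mk, hU.map_zero]
    · induction p using Projectivization.ind with
      | h ψ hψ => simp only [projUnitary_mk, hU.map_add]

end Trajectory

end ProjectiveHilbert

/-! ### The main theorem -/

theorem mainTheorem8 {E : Type*} [NormedAddCommGroup E] [InnerProductSpace ℂ E] [CompleteSpace E]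
    (hbar : ℝ) (hbar_pos : 0 < hbar) (A : E →ₗ.[ℂ] E) (hA : IsSelfAdjoint A) :
    -- the inclusion of `P(D(A))` into `P(E)` and the expectation value function are smooth
    ContMDiff 𝓘(ℝ, Model (Dom A)) 𝓘(ℝ, Model E) ∞ (projIncl A) ∧
    ContMDiff 𝓘(ℝ, Model (Dom A)) 𝓘(ℝ, ℝ) ∞ (expectation A) ∧
    -- the Hamiltonian vector field and the Schrödinger evolution exist and are unique
    (∃! X : (x : ℙ ℂ (Dom A)) → TangentSpace 𝓘(ℝ, Model E) (projIncl A x),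
      IsHamiltonianVectorField hbar A X) ∧
    (∃! U : ℝ → E ≃ₗᵢ[ℂ] E, IsSchrodingerEvolution hbar A U) ∧
    -- the Hamiltonian flow is the projection of the Schrödinger evolution
    ∀ (X : (x : ℙ ℂ (Dom A)) → TangentSpace 𝓘(ℝ, Model E) (projIncl A x))
      (U : ℝ → E ≃ₗᵢ[ℂ] E),
      IsHamiltonianVectorField hbar A X → IsSchrodingerEvolution hbar A U →
        (∀ Φ : ℝ → ℙ ℂ E → ℙ ℂ E, IsFlowOf A X Φ ↔ Φ = fun t => projUnitary (U t)) ∧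
        (∀ (J : Set ℝ) (c : ℝ → ℙ ℂ (Dom A)), IsOpen J → J.OrdConnected → 0 ∈ J →
          IsTrajectoryOn A X c J →
          ∀ t ∈ J, projIncl A (c t) = projUnitary (U t) (projIncl A (c 0))) := by
  have hne := hbar_pos.ne'
  obtain ⟨U₀, hU₀⟩ := hA.exists_isSchrodingerEvolution hbar
  refine ⟨contMDiff_projIncl, contMDiff_expectation,
    ⟨hamiltonianVector A hbar, isHamiltonianVectorField_hamiltonianVector hA hne,
      fun X hX => hX.eq_hamiltonianVector hA hne⟩,
    ⟨U₀, hU₀, fun U hU => hA.isSchrodingerEvolution_unique hU hU₀⟩, fun X U hX hU => ?_⟩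
  obtain rfl := hX.eq_hamiltonianVector hA hne
  exact ⟨isFlowOf_hamiltonianVector_iff hA hU, fun J c hJ hJc h0 hc t ht =>
    eq_projUnitary_of_isTrajectoryOn hA hU hJ hJc h0 hc ht⟩
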